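/- Let $\Upsilon$ be a finite set, $\Omega=\Upsilon^{\mathbb Z^2}$ with the product $\sigma$-algebra, and for $V\subseteq\mathbb Z^2$ let $\mathcal F_V$ be the $\sigma$-algebra generated by the projection $\omega\mapsto\omega_V$. Let $P$ be a probability measure on $\Omega$ such that - $P$ is stationary, i.e. invariant under all shifts $\theta_v\omega(u)=\omega(u+v)$, $v\in\mathbb Z^2$; - $P$ satisfies the strong $0$-$1$ law: for every $J\subseteq\mathbb Z^2$ the $\sigma$-algebras $\mathcal F_J$ and $\bigcap_{V\subset\mathbb Z^2\text{ finite}}\mathcal F_{J\cup(\mathbb Z^2\setminus V)}$ coincide modulo $P$; - there is $c>0$ such that $P[\omega_{(0,0)}=y\mid A]>c$ for every $y\in\Upsilon$ and every $A\in\mathcal F_{\mathbb Z^2\setminus\{(0,0)\}}$ with $P(A)>0$. For finite $V\subset\mathbb Z^2$ let $\mathcal I(P_V)(\omega)=-\log P[\omega_V]$ be the information of $P$ restricted to $V$. Let $0\le\lambda\le1$, and write $[r]$ for the integer part (floor) of $r\in\mathbb R$. For $t\in[0,1)$ let $\mathcal P_{\lambda,t}=\mathcal F_{\{(z,[\lambda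 z+t])\,:\,z\in\mathbb Z,\ z\le-1\}}$ and define the specific entropy of $P$ along the line with slope $\lambda$ by $$h_\lambda(P)=\int_0^1E\big[H\big(P_0[\,\cdot\mid\mathcal P_{\lambda,t}](\omega)\big)\big]\,dt,$$ where $P_0[\,\cdot\mid\mathcal P_{\lambda,t}](\omega)$ is the conditional distribution of $\omega_{(0,0)}$ given $\mathcal P_{\lambda,t}$ and $H(\mu)=-\sum_{y\in\Upsilon}\mu(y)\log\mu(y)$. Let $x<\widetilde x$ be real numbers. For $a\in\mathbb R$ and $n\in\mathbb N$, the $n$-th blowup of the line segment $\{(s,\lambda s+a): x\le s\le\widetilde x\}$ is the graph of $s\mapsto\lambda s+na$ over $[nx,n\widetilde x]$; let $$L_n(a)=\{(z,[\lambda z+na])\,:\,z\in\mathbb Z,\ nx\le z\le n\widetilde x\}$$ be its lattice approximation. Then $$\lim_{n\to\infty}\ \sup_{a\in\mathbb R}\ \Big\|\frac1{|L_n(a)|}\,\mathcal I(P_{L_n(a)})-h_\lambda(P)\Big\|_{L^1(P)}=0 .$$ The same holds for line segments of all other slopes, in the following sense: if $R$ is one of the four maps $(u,v)\mapsto(u,\pm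 v)$, $(u,v)\mapsto(\pm v,u)$ of $\mathbb Z^2$, then the conclusion remains true when the sets $L_n(a)$, and also the sets of sites $\{(z,[\lambda z+t]):z\le-1\}$ which define $\mathcal P_{\lambda,t}$ and thereby the limit, are replaced by their images under $R$. -/

import Mathlib

open MeasureTheory ProbabilityTheory Filter Topology

/-- The shift transformation `(θ_v ω)(u) = ω (u + v)` on configurations over the lattice `ℤ²`. -/
def shift {Υ : Type*} (v : ℤ × ℤ) (ω : ℤ × ℤ → Υ) : ℤ × ℤ → Υ := fun u => ω (u + v)

/-- `P` is stationary: invariant under all shift transformations. -/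
def IsStationaryField {Υ : Type*} [MeasurableSpace Υ] (P : Measure (ℤ × ℤ → Υ)) : Prop :=
  ∀ v : ℤ × ℤ, MeasurePreserving (shift v) P P

/-- Two families of events coincide modulo `P`: each event of one equals, up to a `P`-null set,
an event of the other. -/
def CoincideMod {Ω : Type*} [MeasurableSpace Ω] (P : Measure Ω) (m₁ m₂ : MeasurableSpace Ω) :
    Prop :=
  (∀ A, MeasurableSet[m₁] A → ∃ B, MeasurableSet[m₂] B ∧ A =ᵐ[P] B) ∧
    ∀ B, MeasurableSet[m₂] B → ∃ A, MeasurableSet[m₁] A ∧ B =ᵐ[P] A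

/-- The strong 0-1 law: for every `J ⊆ ℤ²`, the σ-algebra `F_J` (events depending only on the sites
in `J`) coincides modulo `P` with `⋂_V F_{J ∪ (ℤ² \ V)}`, `V` ranging over the finite sets of
sites. -/
def StrongZeroOneLaw {Υ : Type*} [MeasurableSpace Υ] (P : Measure (ℤ × ℤ → Υ)) : Prop :=
  ∀ J : Set (ℤ × ℤ),
    CoincideMod P (cylinderEvents (X := fun _ : ℤ × ℤ => Υ) J)
      (⨅ V : Finset (ℤ × ℤ),
        cylinderEvents (X := fun _ : ℤ × ℤ => Υ) (J ∪ (V : Set (ℤ × ℤ))ᶜ))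

/-- There is `c > 0` such that, conditionally on any event `A` of positive probability which depends
only on the sites other than the origin, every letter appears at the origin with probability greater
than `c`. -/
def UniformlyPositive {Υ : Type*} [MeasurableSpace Υ] (P : Measure (ℤ × ℤ → Υ)) : Prop :=
  ∃ c : ℝ, 0 < c ∧ ∀ A : Set (ℤ × ℤ → Υ),
    MeasurableSet[cylinderEvents (X := fun _ : ℤ × ℤ => Υ) {(0 : ℤ × ℤ)}ᶜ] A → P A ≠ 0 →
      ∀ y : Υ, c < (ProbabilityTheory.cond P A).real {ω | ω 0 = y}

/-- The information `-log P[ω_V]` of `P` restricted to the finite set of sites `V`. -/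
noncomputable def information {Υ : Type*} [MeasurableSpace Υ] (P : Measure (ℤ × ℤ → Υ))
    (V : Finset (ℤ × ℤ)) (ω : ℤ × ℤ → Υ) : ℝ :=
  -Real.log (P.real {ω' | ∀ v ∈ V, ω' v = ω v})

/-- The lattice symmetry `(u, v) ↦ (u, ε v)`, followed by the exchange of the two coordinates if
`swap` is true. Applied to lines `v = l u + a` with `0 ≤ l ≤ 1`, the four symmetries yield
the lines of all slopes: those with slope in `[-1, 1]` as functions of the `x`-axis, and
the others as functions of the `y`-axis. -/
def orient (swap : Bool) (ε : ℤˣ) (p : ℤ × ℤ) : ℤ × ℤ :=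
  if swap then ((ε : ℤ) * p.2, p.1) else (p.1, (ε : ℤ) * p.2)

/-- The site `(z, [l z + a])` of the lattice approximation of the line with slope `l` and
intercept `a`, transported by the given lattice symmetry. -/
noncomputable def latticePoint (swap : Bool) (ε : ℤˣ) (l a : ℝ) (z : ℤ) : ℤ × ℤ :=
  orient swap ε (z, ⌊l * z + a⌋)

/-- The lattice approximation `L_n(a)` of the `n`-th blowup of the line segment
`{(s, l s + a) | x ≤ s ≤ x'}` (transported by the lattice symmetry). The blowup
`{(n s, n (l s + a)) | x ≤ s ≤ x'}` is the graph of `s ↦ l s + n a` on `[n x, n x']`, so this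
consists of the sites `(z, [l z + n a])` with `z` an integer of `[n x, n x']`. -/
noncomputable def segmentApprox (swap : Bool) (ε : ℤˣ) (l x x' : ℝ) (n : ℕ) (a : ℝ) :
    Finset (ℤ × ℤ) :=
  (Finset.Icc ⌈(n : ℝ) * x⌉ ⌊(n : ℝ) * x'⌋).image (latticePoint swap ε l ((n : ℝ) * a))

/-- The expected entropy `E[H(P₀[· | F_W](ω))]` of the conditional distribution of the letter at
the origin given the configuration on `W`. -/
noncomputable def conditionalEntropy {Υ : Type*} [Fintype Υ] [MeasurableSpace Υ]
    (P : Measure (ℤ × ℤ → Υ)) (W : Set (ℤ × ℤ)) : ℝ :=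
  ∫ ω, ∑ y : Υ,
    Real.negMulLog
      ((P⟦{ω' : ℤ × ℤ → Υ | ω' 0 = y} | cylinderEvents (X := fun _ : ℤ × ℤ => Υ) W⟧) ω) ∂P

/-- The specific entropy of `P` along a line: the average over the intercept `t ∈ [0, 1]` of the
expected entropy at the origin given the past `{(z, [l z + t]) | z ≤ -1}` along the line
(transported by the lattice symmetry). -/
noncomputable def lineEntropy {Υ : Type*} [Fintype Υ] [MeasurableSpace Υ]
    (P : Measure (ℤ × ℤ → Υ)) (swap : Bool) (ε : ℤˣ) (l : ℝ) : ℝ :=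
  ∫ t in (0 : ℝ)..1, conditionalEntropy P (latticePoint swap ε l t '' Set.Iic (-1))

/-! List the sites of a segment in order along the line. The chain rule `information_image_range`
turns the information into a sum of conditional informations of each letter given the earlier ones.
By stationarity, each summand is a translate of `condInformation P c W`, where `W` is the past seen
from the current site. It remains to control the fluctuations of this sum and the average of its
means, both uniformly in the position of the line.

Fluctuations: the strong 0-1 law makes conditioning on `W` nearly the same as conditioning on `W ∩
box r`, with one `r` for all `W` (`exists_box_condSecondMoment_sub_le`). For a fixed `W` this
follows from Lévy's upward and downward theorems. Uniformity comes from monotonicity in `W` and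
compactness of the space of all subsets of ℤ². The lower bound `c` makes the logarithm Lipschitz, so
the estimate passes to the informations. After truncation only finitely many local functions occur.
Tail triviality, the 0-1 law for the empty set, decorrelates their distant translates, and a path
without self-intersections has few pairs of nearby sites. A variance bound then gives a law of large
numbers for all such paths at once (`exists_forall_integral_abs_sum_condInformation_le`).

Means: seen from successive sites, the line keeps its slope and its intercept modulo 1 rotates by
`l`. With the past truncated to `n` sites, the mean is a step function of the intercept which jumps
only at multiples of `l` modulo 1. The indicator of an interval with such endpoints is a coboundary
up to a constant, so orbit sums stay within a bounded distance of the integral, for rational and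
irrational slopes alike and for every starting point (`boundedDiscrepancy_linePast`). Undoing the
truncation gives the line entropy (`exists_forall_abs_sum_integral_condInformation_sub_le`). -/

set_option linter.unusedSectionVars false

/-! ### Second moments of conditional expectations along monotone sequences of σ-algebras. -/

section ConditionalExpectation

variable {Ω : Type*} {m m' m₁ m₂ : MeasurableSpace Ω} {m0 : MeasurableSpace Ω} {μ : Measure Ω}

theorem abs_condExp_le {f : Ω → ℝ} {M : ℝ}
    (hM : ∀ᵐ ω ∂μ, |f ω| ≤ M) : ∀ᵐ ω ∂μ, |(μ[f | m]) ω| ≤ M :=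
  ae_bdd_abs_condExp_of_ae_bdd_abs hM

theorem aestronglyMeasurable_condExp {f : Ω → ℝ} :
    AEStronglyMeasurable (μ[f | m]) μ :=
  integrable_condExp.aestronglyMeasurable

theorem integrable_condExp_mul {f : Ω → ℝ} {M : ℝ}
    (hM : ∀ᵐ ω ∂μ, |f ω| ≤ M) : Integrable (fun ω => (μ[f | m]) ω * (μ[f | m']) ω) μ :=
  integrable_condExp.bdd_mul aestronglyMeasurable_condExp (abs_condExp_le hM)

variable [IsProbabilityMeasure μ]

theorem integrable_of_abs_le {f : Ω → ℝ} (hf : AEStronglyMeasurable f μ) {M : ℝ}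
    (hM : ∀ᵐ ω ∂μ, |f ω| ≤ M) : Integrable f μ :=
  Integrable.of_bound hf M hM

theorem integral_mul_condExp (hm : m ≤ m0) {f g : Ω → ℝ}
    (hf : Integrable f μ) (hg : StronglyMeasurable[m] g) {M : ℝ} (hM : ∀ᵐ ω ∂μ, |g ω| ≤ M) :
    ∫ ω, g ω * (μ[f | m]) ω ∂μ = ∫ ω, g ω * f ω ∂μ := by
  have hgf : Integrable (g * f) μ :=
    hf.bdd_mul (hg.mono hm).aestronglyMeasurable hM
  have h := condExp_mul_of_stronglyMeasurable_left hg hgf hf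
  calc ∫ ω, g ω * (μ[f | m]) ω ∂μ = ∫ ω, (μ[g * f | m]) ω ∂μ :=
        (integral_congr_ae h).symm
    _ = ∫ ω, (g * f) ω ∂μ := integral_condExp hm
    _ = _ := rfl

/-- Pythagoras for nested conditional expectations. -/
theorem integral_sq_condExp_sub (h12 : m₁ ≤ m₂) (h2 : m₂ ≤ m0)
    {f : Ω → ℝ} (hf : AEStronglyMeasurable f μ) {M : ℝ} (hM : ∀ᵐ ω ∂μ, |f ω| ≤ M) :
    ∫ ω, ((μ[f | m₂]) ω - (μ[f | m₁]) ω) ^ 2 ∂μ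
      = ∫ ω, (μ[f | m₂]) ω ^ 2 ∂μ - ∫ ω, (μ[f | m₁]) ω ^ 2 ∂μ := by
  have hfi := integrable_of_abs_le hf hM
  have i1 : Integrable (fun ω => (μ[f | m₁]) ω * (μ[f | m₁]) ω) μ := integrable_condExp_mul hM
  have i2 : Integrable (fun ω => (μ[f | m₂]) ω * (μ[f | m₂]) ω) μ := integrable_condExp_mul hM
  have i3 : Integrable (fun ω => (μ[f | m₁]) ω * (μ[f | m₂]) ω) μ := integrable_condExp_mul hM
  have e1 := integral_mul_condExp (h12.trans h2) hfi
    (stronglyMeasurable_condExp (μ := μ) (f := f) (m := m₁)) (abs_condExp_le hM)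
  have e2 := integral_mul_condExp h2 hfi
    ((stronglyMeasurable_condExp (μ := μ) (f := f) (m := m₁)).mono h12) (abs_condExp_le hM)
  have e : ∀ ω, ((μ[f | m₂]) ω - (μ[f | m₁]) ω) ^ 2 = (μ[f | m₂]) ω * (μ[f | m₂]) ω
      - 2 * ((μ[f | m₁]) ω * (μ[f | m₂]) ω) + (μ[f | m₁]) ω * (μ[f | m₁]) ω := fun ω => by ring
  simp_rw [e, sq]
  rw [integral_add (f := fun ω => (μ[f | m₂]) ω * (μ[f | m₂]) ω
      - 2 * ((μ[f | m₁]) ω * (μ[f | m₂]) ω)) (i2.sub (i3.const_mul 2)) i1,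
    integral_sub i2 (i3.const_mul 2), integral_const_mul, e2, ← e1]
  ring

theorem integral_sq_condExp_mono (h12 : m₁ ≤ m₂) (h2 : m₂ ≤ m0)
    {f : Ω → ℝ} (hf : AEStronglyMeasurable f μ) {M : ℝ} (hM : ∀ᵐ ω ∂μ, |f ω| ≤ M) :
    ∫ ω, (μ[f | m₁]) ω ^ 2 ∂μ ≤ ∫ ω, (μ[f | m₂]) ω ^ 2 ∂μ := by
  have h := integral_sq_condExp_sub h12 h2 hf hM
  have : 0 ≤ ∫ ω, ((μ[f | m₂]) ω - (μ[f | m₁]) ω) ^ 2 ∂μ := integral_nonneg fun _ => sq_nonneg _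
  linarith

/-- The square of the mean of a bounded function is at most the mean of its square. -/
theorem sq_integral_le {f : Ω → ℝ} (hf : AEStronglyMeasurable f μ) {M : ℝ}
    (hM : ∀ᵐ ω ∂μ, |f ω| ≤ M) : (∫ ω, f ω ∂μ) ^ 2 ≤ ∫ ω, f ω ^ 2 ∂μ := by
  have hi := integrable_of_abs_le hf hM
  have hi2 : Integrable (fun ω => f ω ^ 2) μ := by
    simp_rw [sq]; exact hi.bdd_mul hf hM
  set a := ∫ ω, f ω ∂μ with ha
  have h : 0 ≤ ∫ ω, (f ω - a) ^ 2 ∂μ := integral_nonneg fun _ => sq_nonneg _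
  have e : ∀ ω, (f ω - a) ^ 2 = f ω ^ 2 - 2 * a * f ω + a ^ 2 := fun ω => by ring
  simp_rw [e] at h
  rw [integral_add (f := fun ω => f ω ^ 2 - 2 * a * f ω) (hi2.sub (hi.const_mul _))
    (integrable_const _), integral_sub hi2 (hi.const_mul _), integral_const_mul, integral_const,
    ← ha, probReal_univ, one_smul] at h
  linarith

/-- **Lévy's upward theorem** for the second moments of conditional expectations. -/
theorem tendsto_integral_sq_condExp_iSup {F : ℕ → MeasurableSpace Ω} (hmono : Monotone F)
    (hle : ∀ n, F n ≤ m0) {f : Ω → ℝ} {M : ℝ} (hM : ∀ᵐ ω ∂μ, |f ω| ≤ M) :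
    Tendsto (fun n => ∫ ω, (μ[f | F n]) ω ^ 2 ∂μ) atTop
      (𝓝 (∫ ω, (μ[f | ⨆ n, F n]) ω ^ 2 ∂μ)) := by
  let ℱ : Filtration ℕ m0 := ⟨F, hmono, hle⟩
  refine tendsto_integral_of_dominated_convergence (fun _ => M ^ 2)
    (fun n => (continuous_pow 2).comp_aestronglyMeasurable aestronglyMeasurable_condExp)
    (integrable_const _) (fun n => ?_) ?_
  · filter_upwards [abs_condExp_le (m := F n) hM] with ω hω
    rw [Real.norm_eq_abs, abs_pow]
    exact pow_le_pow_left₀ (abs_nonneg _) hω 2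
  · filter_upwards [tendsto_ae_condExp (μ := μ) (ℱ := ℱ) f] with ω hω
    exact hω.pow 2

/-- **Lévy's downward theorem** for the second moments of conditional expectations. -/
theorem tendsto_integral_sq_condExp_iInf {F : ℕ → MeasurableSpace Ω} (hanti : Antitone F)
    (hle : ∀ n, F n ≤ m0) {f : Ω → ℝ} (hf : AEStronglyMeasurable f μ) {M : ℝ}
    (hM : ∀ᵐ ω ∂μ, |f ω| ≤ M) :
    Tendsto (fun n => ∫ ω, (μ[f | F n]) ω ^ 2 ∂μ) atTop
      (𝓝 (∫ ω, (μ[f | ⨅ n, F n]) ω ^ 2 ∂μ)) := by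
  have hfi := integrable_of_abs_le hf hM
  set a : ℕ → ℝ := fun n => ∫ ω, (μ[f | F n]) ω ^ 2 ∂μ with ha
  have hanti_a : Antitone a := fun i j hij => integral_sq_condExp_mono (hanti hij) (hle i) hf hM
  have hbdd : BddBelow (Set.range a) :=
    ⟨0, by rintro _ ⟨n, rfl⟩; exact integral_nonneg fun _ => sq_nonneg _⟩
  have hlim := tendsto_atTop_ciInf hanti_a hbdd
  have hmem : ∀ n, MemLp (μ[f | F n]) 2 μ := fun n =>
    MemLp.of_bound aestronglyMeasurable_condExp M (abs_condExp_le hM)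
  -- the conditional expectations form a Cauchy sequence in `L²`
  have hdist : ∀ i j, i ≤ j → dist ((hmem i).toLp _) ((hmem j).toLp _) ^ 2 = a i - a j := by
    intro i j hij
    rw [← integral_sq_condExp_sub (hanti hij) (hle i) hf hM, dist_eq_norm, ← MemLp.toLp_sub,
      ← real_inner_self_eq_norm_sq, L2.inner_def]
    refine integral_congr_ae ?_
    filter_upwards [MemLp.coeFn_toLp ((hmem i).sub (hmem j))] with ω hω
    rw [hω]
    simp [sq]
  have hcauchy : CauchySeq fun n => (hmem n).toLp (μ[f | F n]) := by
    rw [Metric.cauchySeq_iff']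
    intro ε hε
    have h1 : ∀ᶠ n in atTop, a n < iInf a + ε ^ 2 :=
      hlim.eventually (gt_mem_nhds (by have := pow_pos hε 2; linarith))
    obtain ⟨N, hN⟩ := h1.exists
    refine ⟨N, fun n hn => ?_⟩
    have h2 := hdist N n hn
    have h3 : iInf a ≤ a n := ciInf_le hbdd n
    rw [dist_comm]
    exact lt_of_pow_lt_pow_left₀ 2 hε.le (by linarith)
  obtain ⟨G, hG⟩ := cauchySeq_tendsto_of_complete hcauchy
  obtain ⟨ns, hns, hae⟩ := (tendstoInMeasure_of_tendsto_Lp hG).exists_seq_tendsto_ae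
  have hae' : ∀ᵐ ω ∂μ, Tendsto (fun k => (μ[f | F (ns k)]) ω) atTop (𝓝 (G ω)) := by
    have : ∀ᵐ ω ∂μ, ∀ n, ((hmem n).toLp (μ[f | F n])) ω = (μ[f | F n]) ω :=
      ae_all_iff.2 fun n => (hmem n).coeFn_toLp
    filter_upwards [hae, this] with ω h1 h2
    simpa only [h2] using h1
  -- a version of the limit which is measurable for the intersection
  set g : Ω → ℝ := fun ω => limsup (fun k => (μ[f | F (ns k)]) ω) atTop with hg
  have hgmeas : Measurable[⨅ n, F n] g := by
    intro s hs
    rw [MeasurableSpace.measurableSet_iInf]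
    intro n
    -- Dropping the first `n` terms leaves the limsup unchanged, and the remaining ones are `F
    -- n`-measurable because `n ≤ ns (k + n)`.
    have hshift : g = fun ω => limsup (fun k => (μ[f | F (ns (k + n))]) ω) atTop := by
      funext ω
      exact (limsup_nat_add (fun k => (μ[f | F (ns k)]) ω) n).symm
    rw [hshift]
    refine (Measurable.limsup (mδ := F n) fun k => ?_) hs
    exact ((stronglyMeasurable_condExp).mono
      (hanti ((Nat.le_add_left n k).trans (hns.id_le _)))).measurable
  have hlim_g : ∀ᵐ ω ∂μ, Tendsto (fun k => (μ[f | F (ns k)]) ω) atTop (𝓝 (g ω)) := by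
    filter_upwards [hae'] with ω hω
    rw [hg]
    simpa only [hω.limsup_eq] using hω
  have hinf : (⨅ n, F n) ≤ m0 := (iInf_le F 0).trans (hle 0)
  have hbound : ∀ᵐ ω ∂μ, ∀ k, |(μ[f | F (ns k)]) ω| ≤ M :=
    ae_all_iff.2 fun k => abs_condExp_le hM
  have hgM : ∀ᵐ ω ∂μ, |g ω| ≤ M := by
    filter_upwards [hlim_g, hbound] with ω h1 h2
    exact le_of_tendsto h1.abs (Eventually.of_forall h2)
  have hgi : Integrable g μ :=
    integrable_of_abs_le (hgmeas.mono hinf le_rfl).aestronglyMeasurable hgM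
  have hcond : g =ᵐ[μ] μ[f | ⨅ n, F n] := by
    refine ae_eq_condExp_of_forall_setIntegral_eq hinf hfi (fun s _ _ => hgi.integrableOn)
      (fun s hs _ => ?_) hgmeas.stronglyMeasurable.aestronglyMeasurable
    have h1 : Tendsto (fun k => ∫ ω in s, (μ[f | F (ns k)]) ω ∂μ) atTop
        (𝓝 (∫ ω in s, g ω ∂μ)) := by
      refine tendsto_integral_of_dominated_convergence (fun _ => M)
        (fun n => aestronglyMeasurable_condExp.restrict) (integrable_const _)
        (fun n => ae_restrict_of_ae ?_) (ae_restrict_of_ae hlim_g)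
      filter_upwards [hbound] with ω hω using hω n
    have h2 : ∀ k, ∫ ω in s, (μ[f | F (ns k)]) ω ∂μ = ∫ ω in s, f ω ∂μ := fun k =>
      setIntegral_condExp (hle _) hfi (iInf_le F (ns k) s hs)
    simp_rw [h2] at h1
    exact tendsto_nhds_unique h1 tendsto_const_nhds
  have hsub : Tendsto (fun k => a (ns k)) atTop (𝓝 (∫ ω, (μ[f | ⨅ n, F n]) ω ^ 2 ∂μ)) := by
    have : ∫ ω, (μ[f | ⨅ n, F n]) ω ^ 2 ∂μ = ∫ ω, g ω ^ 2 ∂μ :=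
      integral_congr_ae (by filter_upwards [hcond] with ω hω; rw [hω])
    rw [this]
    refine tendsto_integral_of_dominated_convergence (fun _ => M ^ 2)
      (fun n => (continuous_pow 2).comp_aestronglyMeasurable aestronglyMeasurable_condExp)
      (integrable_const _) (fun n => ?_) ?_
    · filter_upwards [hbound] with ω hω
      rw [Real.norm_eq_abs, abs_pow]
      exact pow_le_pow_left₀ (abs_nonneg _) (hω n) 2
    · filter_upwards [hlim_g] with ω hω using hω.pow 2
  -- The whole sequence of second moments converges by monotonicity, so the subsequence identifies
  -- its limit.
  have := tendsto_nhds_unique (hlim.comp hns.tendsto_atTop) hsub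
  rwa [this] at hlim

/-- Conditional expectations on nested σ-algebras which coincide modulo `μ` are equal. -/
theorem condExp_eq_of_coincideMod (h12 : m₁ ≤ m₂) (h2 : m₂ ≤ m0)
    (h : CoincideMod μ m₁ m₂) {f : Ω → ℝ} (hf : Integrable f μ) :
    μ[f | m₁] =ᵐ[μ] μ[f | m₂] := by
  refine ae_eq_condExp_of_forall_setIntegral_eq h2 hf
    (fun s _ _ => integrable_condExp.integrableOn) (fun s hs _ => ?_)
    (stronglyMeasurable_condExp.mono h12).aestronglyMeasurable
  obtain ⟨t, ht, hst⟩ := h.2 s hs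
  rw [setIntegral_congr_set hst, setIntegral_congr_set hst,
    setIntegral_condExp (h12.trans h2) hf ht]

end ConditionalExpectation

/-! ### The strong 0-1 law: uniform locality and mixing. -/

/-- The events which depend only on the sites in `W`. -/
abbrev siteEvents (Υ : Type*) [MeasurableSpace Υ] (W : Set (ℤ × ℤ)) :
    MeasurableSpace (ℤ × ℤ → Υ) :=
  cylinderEvents (X := fun _ : ℤ × ℤ => Υ) W

/-- The square box of radius `n` around the origin. -/
noncomputable def box (n : ℕ) : Finset (ℤ × ℤ) :=
  Finset.Icc (-(n : ℤ), -(n : ℤ)) ((n : ℤ), (n : ℤ))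

theorem mem_box {n : ℕ} {p : ℤ × ℤ} : p ∈ box n ↔ |p.1| ≤ n ∧ |p.2| ≤ n := by
  simp only [box, Finset.mem_Icc, Prod.le_def, abs_le]
  tauto

theorem box_mono : Monotone box := by
  intro a b hab p hp
  rw [mem_box] at hp ⊢
  have : (a : ℤ) ≤ b := by exact_mod_cast hab
  omega

theorem exists_subset_box (V : Finset (ℤ × ℤ)) : ∃ n, V ⊆ box n := by
  induction V using Finset.induction_on with
  | empty => exact ⟨0, by simp⟩
  | insert p V _ ih =>
    obtain ⟨n, hn⟩ := ih
    refine ⟨max n (max p.1.natAbs p.2.natAbs), Finset.insert_subset ?_ ?_⟩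
    · rw [mem_box]; push_cast; simp
    · exact hn.trans (box_mono (le_max_left _ _))

section Field

variable {Υ : Type*} [MeasurableSpace Υ]

theorem iSup_siteEvents_inter_box (W : Set (ℤ × ℤ)) :
    ⨆ n : ℕ, siteEvents Υ (W ∩ box n) = siteEvents Υ W := by
  refine le_antisymm (iSup_le fun n => cylinderEvents_mono Set.inter_subset_left) ?_
  refine iSup₂_le fun p hp => ?_
  obtain ⟨n, hn⟩ := exists_subset_box {p}
  refine le_trans ?_ (le_iSup _ n)
  exact le_iSup₂_of_le p ⟨hp, by simpa using hn⟩ le_rfl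

theorem iInf_siteEvents_union_compl_box (W : Set (ℤ × ℤ)) :
    ⨅ n : ℕ, siteEvents Υ (W ∪ (box n : Set (ℤ × ℤ))ᶜ)
      = ⨅ V : Finset (ℤ × ℤ), siteEvents Υ (W ∪ (V : Set (ℤ × ℤ))ᶜ) := by
  refine le_antisymm (le_iInf fun V => ?_) (le_iInf fun n => iInf_le _ (box n))
  obtain ⟨n, hn⟩ := exists_subset_box V
  refine (iInf_le _ n).trans (cylinderEvents_mono ?_)
  exact Set.union_subset_union_right _ (Set.compl_subset_compl.2 (by exact_mod_cast hn))

theorem measurable_shift_siteEvents {V W : Set (ℤ × ℤ)} {w : ℤ × ℤ} (h : ∀ u ∈ V, u + w ∈ W) :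
    Measurable[siteEvents Υ W, siteEvents Υ V] (shift (Υ := Υ) w) :=
  measurable_cylinderEvents_iff.2 fun _ hu => measurable_cylinderEvent_apply (h _ hu)

variable {P : Measure (ℤ × ℤ → Υ)}

/-- The second moment of the conditional expectation of `f` given the sites in `W`. -/
noncomputable def condSecondMoment (P : Measure (ℤ × ℤ → Υ)) (f : (ℤ × ℤ → Υ) → ℝ)
    (W : Set (ℤ × ℤ)) : ℝ :=
  ∫ ω, (P[f | siteEvents Υ W]) ω ^ 2 ∂P

variable [IsProbabilityMeasure P] {f : (ℤ × ℤ → Υ) → ℝ} {M : ℝ}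

theorem condSecondMoment_mono (hf : AEStronglyMeasurable f P) (hM : ∀ᵐ ω ∂P, |f ω| ≤ M) :
    Monotone (condSecondMoment P f) := fun _ _ h =>
  integral_sq_condExp_mono (cylinderEvents_mono h) cylinderEvents_le_pi hf hM

theorem integral_sq_condExp_siteEvents_sub (hf : AEStronglyMeasurable f P)
    (hM : ∀ᵐ ω ∂P, |f ω| ≤ M) {V W : Set (ℤ × ℤ)} (h : V ⊆ W) :
    ∫ ω, ((P[f | siteEvents Υ W]) ω - (P[f | siteEvents Υ V]) ω) ^ 2 ∂P
      = condSecondMoment P f W - condSecondMoment P f V :=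
  integral_sq_condExp_sub (cylinderEvents_mono h) cylinderEvents_le_pi hf hM

theorem tendsto_condSecondMoment_inter_box (hM : ∀ᵐ ω ∂P, |f ω| ≤ M) (W : Set (ℤ × ℤ)) :
    Tendsto (fun n => condSecondMoment P f (W ∩ box n)) atTop (𝓝 (condSecondMoment P f W)) := by
  have h := tendsto_integral_sq_condExp_iSup (μ := P) (F := fun n => siteEvents Υ (W ∩ box n))
    (fun a b hab => cylinderEvents_mono
      (Set.inter_subset_inter_right _ (by exact_mod_cast box_mono hab)))
    (fun n => cylinderEvents_le_pi) hM
  rwa [iSup_siteEvents_inter_box] at h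

/-- Lévy's downward theorem leads to the intersection of the σ-algebras, and the strong 0-1 law for
`J = W` says that this intersection adds only null sets to the events of `W`. -/
theorem tendsto_condSecondMoment_union_compl_box (hzero : StrongZeroOneLaw P)
    (hf : AEStronglyMeasurable f P) (hM : ∀ᵐ ω ∂P, |f ω| ≤ M) (W : Set (ℤ × ℤ)) :
    Tendsto (fun n => condSecondMoment P f (W ∪ (box n : Set (ℤ × ℤ))ᶜ)) atTop
      (𝓝 (condSecondMoment P f W)) := by
  have h := tendsto_integral_sq_condExp_iInf (μ := P)
    (F := fun n => siteEvents Υ (W ∪ (box n : Set (ℤ × ℤ))ᶜ))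
    (fun a b hab => cylinderEvents_mono
      (Set.union_subset_union_right _ (Set.compl_subset_compl.2 (by exact_mod_cast box_mono hab))))
    (fun n => cylinderEvents_le_pi) hf hM
  have hle : siteEvents Υ W ≤ ⨅ V : Finset (ℤ × ℤ), siteEvents Υ (W ∪ (V : Set (ℤ × ℤ))ᶜ) :=
    le_iInf fun V => cylinderEvents_mono Set.subset_union_left
  have heq := condExp_eq_of_coincideMod hle ((iInf_le _ ∅).trans cylinderEvents_le_pi) (hzero W)
    (integrable_of_abs_le hf hM)
  rw [iInf_siteEvents_union_compl_box] at h
  have : condSecondMoment P f W = _ :=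
    integral_congr_ae (by filter_upwards [heq] with ω hω; rw [hω])
  rwa [this]

/-- Under the strong 0-1 law, conditional expectations given the sites in `W` are approximated by
those given finitely many of these sites, uniformly in `W`. -/
theorem exists_box_condSecondMoment_sub_le (hzero : StrongZeroOneLaw P)
    (hf : AEStronglyMeasurable f P) (hM : ∀ᵐ ω ∂P, |f ω| ≤ M) {δ : ℝ} (hδ : 0 < δ) :
    ∃ n : ℕ, ∀ W : Set (ℤ × ℤ),
      condSecondMoment P f W - condSecondMoment P f (W ∩ box n) ≤ δ := by
  have hmono := condSecondMoment_mono (P := P) hf hM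
  have hloc : ∀ W : Set (ℤ × ℤ), ∃ n : ℕ,
      condSecondMoment P f (W ∪ (box n : Set (ℤ × ℤ))ᶜ)
        - condSecondMoment P f (W ∩ box n) < δ := by
    intro W
    have h := (tendsto_condSecondMoment_union_compl_box hzero hf hM W).sub
      (tendsto_condSecondMoment_inter_box hM W)
    rw [sub_self] at h
    exact (h.eventually (gt_mem_nhds hδ)).exists
  choose r hr using hloc
  -- Sets of sites are coded as points of the compact space `ℤ × ℤ → Bool`. Each has a
  -- neighbourhood, given by agreement on a box, where its own radius serves.
  set T : (ℤ × ℤ → Bool) → Set (ℤ × ℤ) := fun w => {p | w p = true} with hT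
  set N : (ℤ × ℤ → Bool) → Set (ℤ × ℤ → Bool) :=
    fun w => {w' | ∀ p ∈ box (r (T w)), w' p = w p} with hN
  have hNopen : ∀ w, N w ∈ 𝓝 w := by
    intro w
    have : N w = (box (r (T w)) : Set (ℤ × ℤ)).pi fun p => {w p} := by
      ext w'; simp [hN, Set.mem_pi]
    rw [this]
    exact set_pi_mem_nhds (Finset.finite_toSet _) fun p _ => by simp
  obtain ⟨t, -, ht⟩ := (isCompact_univ (X := ℤ × ℤ → Bool)).elim_nhds_subcover N
    fun w _ => hNopen w
  refine ⟨t.sup fun w => r (T w), fun W => ?_⟩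
  classical
  have hW : (fun p => decide (p ∈ W)) ∈ ⋃ w ∈ t, N w := ht (Set.mem_univ _)
  simp only [Set.mem_iUnion] at hW
  obtain ⟨w, hwt, hw⟩ := hW
  have hmem : ∀ p ∈ box (r (T w)), (p ∈ W ↔ p ∈ T w) := by
    intro p hp
    have := hw p hp
    simp only [hT, Set.mem_ofPred_eq, ← this, decide_eq_true_eq]
  have hle : r (T w) ≤ t.sup fun w => r (T w) := Finset.le_sup (f := fun w => r (T w)) hwt
  -- `W` and `W ∩ box` lie between `T w ∩ box (r (T w))` and `T w` together with all sites outside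
  -- that box. By monotonicity the gap for `W` is at most the one for `T w`.
  have h1 : condSecondMoment P f W
      ≤ condSecondMoment P f (T w ∪ (box (r (T w)) : Set (ℤ × ℤ))ᶜ) := by
    refine hmono fun p hp => ?_
    by_cases h : p ∈ box (r (T w))
    · exact Or.inl ((hmem p h).1 hp)
    · exact Or.inr (by simpa using h)
  have h2 : condSecondMoment P f (T w ∩ box (r (T w)))
      ≤ condSecondMoment P f (W ∩ box (t.sup fun w => r (T w))) := by
    refine hmono fun p hp => ⟨(hmem p hp.2).2 hp.1, ?_⟩
    exact box_mono hle hp.2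
  have := hr (T w)
  linarith

/-- A bounded function is asymptotically uncorrelated with the bounded functions of the
configuration outside a large box. -/
theorem exists_box_abs_cov_le (hzero : StrongZeroOneLaw P)
    (hf : AEStronglyMeasurable f P) (hM : ∀ᵐ ω ∂P, |f ω| ≤ M) (K : ℝ) {δ : ℝ} (hδ : 0 < δ) :
    ∃ n : ℕ, ∀ g : (ℤ × ℤ → Υ) → ℝ,
      StronglyMeasurable[siteEvents Υ (box n : Set (ℤ × ℤ))ᶜ] g → (∀ ω, |g ω| ≤ K) →
      |∫ ω, g ω * f ω ∂P - (∫ ω, g ω ∂P) * ∫ ω, f ω ∂P| ≤ δ := by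
  have hfi := integrable_of_abs_le hf hM
  -- For the empty set the limit is the second moment of a constant: far from the origin, the
  -- conditional expectation of `f` is close in L² to its mean.
  have hlim := tendsto_condSecondMoment_union_compl_box hzero hf hM ∅
  simp only [Set.empty_union] at hlim
  have hpos : 0 < δ ^ 2 / (K ^ 2 + 1) := by positivity
  obtain ⟨n, hn⟩ := (hlim.eventually (gt_mem_nhds (lt_add_of_pos_right _ hpos))).exists
  refine ⟨n, fun g hg hgK => ?_⟩
  set E := P[f | siteEvents Υ (box n : Set (ℤ × ℤ))ᶜ] with hE
  set a := ∫ ω, f ω ∂P with ha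
  have hgm : AEStronglyMeasurable g P := (hg.mono cylinderEvents_le_pi).aestronglyMeasurable
  have hgi : Integrable g P := integrable_of_abs_le hgm (Eventually.of_forall hgK)
  have hbot : P[f | siteEvents Υ ∅] = fun _ => a := by
    have : siteEvents Υ ∅ = ⊥ := by simp [siteEvents, cylinderEvents]
    rw [this, condExp_bot]
  have hsq := integral_sq_condExp_siteEvents_sub (P := P) hf hM
    (Set.empty_subset (box n : Set (ℤ × ℤ))ᶜ)
  rw [hbot] at hsq
  have hdm : AEStronglyMeasurable (fun ω => E ω - a) P :=
    aestronglyMeasurable_condExp.sub aestronglyMeasurable_const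
  have hdM : ∀ᵐ ω ∂P, |E ω - a| ≤ M + |a| := by
    filter_upwards [abs_condExp_le (m := siteEvents Υ (box n : Set (ℤ × ℤ))ᶜ) hM] with ω hω
    exact (abs_sub _ _).trans (by gcongr)
  have e1 : ∫ ω, g ω * f ω ∂P - (∫ ω, g ω ∂P) * a = ∫ ω, g ω * (E ω - a) ∂P := by
    simp_rw [mul_sub]
    rw [integral_sub (integrable_condExp.bdd_mul hgm (Eventually.of_forall hgK))
      (hgi.mul_const a), integral_mul_const,
      integral_mul_condExp cylinderEvents_le_pi hfi hg (Eventually.of_forall hgK)]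
  have hbd : ∀ᵐ ω ∂P, |g ω * (E ω - a)| ≤ K * (M + |a|) := by
    filter_upwards [hdM] with ω hω
    rw [abs_mul]
    exact mul_le_mul (hgK ω) hω (abs_nonneg _) ((abs_nonneg _).trans (hgK ω))
  have hdi : Integrable (fun ω => (E ω - a) ^ 2) P := by
    simp_rw [sq]
    exact (integrable_of_abs_le hdm hdM).bdd_mul hdm hdM
  have h2 : ∫ ω, (g ω * (E ω - a)) ^ 2 ∂P ≤ K ^ 2 * ∫ ω, (E ω - a) ^ 2 ∂P := by
    rw [← integral_const_mul]
    refine integral_mono_of_nonneg (Eventually.of_forall fun _ => sq_nonneg _)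
      (hdi.const_mul _) (Eventually.of_forall fun ω => ?_)
    change (g ω * (E ω - a)) ^ 2 ≤ K ^ 2 * (E ω - a) ^ 2
    rw [mul_pow]
    refine mul_le_mul_of_nonneg_right ?_ (sq_nonneg _)
    exact sq_le_sq' (neg_le_of_abs_le (hgK ω)) (le_of_abs_le (hgK ω))
  have h3 : (∫ ω, g ω * (E ω - a) ∂P) ^ 2 ≤ δ ^ 2 := by
    refine (sq_integral_le (hgm.mul hdm) hbd).trans (h2.trans ?_)
    have h4 : ∫ ω, (E ω - a) ^ 2 ∂P ≤ δ ^ 2 / (K ^ 2 + 1) := by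
      rw [hsq]; linarith
    calc K ^ 2 * ∫ ω, (E ω - a) ^ 2 ∂P ≤ K ^ 2 * (δ ^ 2 / (K ^ 2 + 1)) := by gcongr
      _ ≤ (K ^ 2 + 1) * (δ ^ 2 / (K ^ 2 + 1)) := by gcongr; linarith
      _ = δ ^ 2 := by field_simp
  rw [e1]
  exact abs_le_of_sq_le_sq h3 hδ.le

theorem integral_comp_shift (hstat : IsStationaryField P) (w : ℤ × ℤ) {F : (ℤ × ℤ → Υ) → ℝ}
    (hF : AEStronglyMeasurable F P) : ∫ ω, F (shift w ω) ∂P = ∫ ω, F ω ∂P := by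
  have := (hstat w).map_eq
  conv_rhs => rw [← this]
  rw [integral_map (hstat w).measurable.aemeasurable (by rwa [this])]

/-- Mixing: translates of local functions are asymptotically uncorrelated. -/
theorem exists_finset_abs_cov_shift_le (hstat : IsStationaryField P) (hzero : StrongZeroOneLaw P)
    (hf : AEStronglyMeasurable f P) (hM : ∀ᵐ ω ∂P, |f ω| ≤ M) {V : Finset (ℤ × ℤ)}
    {g : (ℤ × ℤ → Υ) → ℝ} (hg : StronglyMeasurable[siteEvents Υ V] g) {K : ℝ}
    (hK : ∀ ω, |g ω| ≤ K) {δ : ℝ} (hδ : 0 < δ) :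
    ∃ S : Finset (ℤ × ℤ), ∀ w ∉ S,
      |∫ ω, g (shift w ω) * f ω ∂P - (∫ ω, g ω ∂P) * ∫ ω, f ω ∂P| ≤ δ := by
  obtain ⟨n, hn⟩ := exists_box_abs_cov_le hzero hf hM K hδ
  -- The excluded `w` are those for which the translate `V + w` meets the box.
  refine ⟨(box n ×ˢ V).image fun p => p.1 - p.2, fun w hw => ?_⟩
  have hmeas : StronglyMeasurable[siteEvents Υ (box n : Set (ℤ × ℤ))ᶜ] fun ω => g (shift w ω) := by
    refine hg.comp_measurable (measurable_shift_siteEvents fun u hu hbox => hw ?_)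
    exact Finset.mem_image.2 ⟨(u + w, u), Finset.mem_product.2 ⟨hbox, hu⟩, by simp⟩
  have h := hn _ hmeas fun ω => hK _
  rwa [integral_comp_shift hstat w (hg.mono cylinderEvents_le_pi).aestronglyMeasurable] at h

end Field

/-! ### Conditional information of a letter and the chain rule. -/

theorem measurable_eval_of_countable {α ι : Type*} {m : MeasurableSpace α} [MeasurableSpace ι]
    [Countable ι] [MeasurableSingletonClass ι] {f : ι → α → ℝ} (hf : ∀ i, Measurable (f i))
    {X : α → ι} (hX : Measurable X) : Measurable fun a => f (X a) a :=
  (measurable_from_prod_countable_right (f := fun p : ι × α => f p.1 p.2) hf).comp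
    (hX.prodMk measurable_id)

section Information

variable {Υ : Type*} [MeasurableSpace Υ]

/-- The configurations which agree with `ω` on `V`. -/
def cylinderAt (V : Finset (ℤ × ℤ)) (ω : ℤ × ℤ → Υ) : Set (ℤ × ℤ → Υ) :=
  {ω' | ∀ v ∈ V, ω' v = ω v}

theorem measurableSet_cylinderAt [MeasurableSingletonClass Υ] (V : Finset (ℤ × ℤ))
    (ω : ℤ × ℤ → Υ) : MeasurableSet[siteEvents Υ V] (cylinderAt V ω) := by
  have : cylinderAt V ω = ⋂ v ∈ V, (fun ω' : ℤ × ℤ → Υ => ω' v) ⁻¹' {ω v} := by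
    ext; simp [cylinderAt]
  rw [this]
  exact Finset.measurableSet_biInter V fun v hv =>
    (measurable_cylinderEvent_apply (Finset.mem_coe.2 hv)) (measurableSet_singleton _)

theorem cylinderAt_insert (V : Finset (ℤ × ℤ)) (v : ℤ × ℤ) (ω : ℤ × ℤ → Υ) :
    cylinderAt (insert v V) ω = cylinderAt V ω ∩ {ω' | ω' v = ω v} := by
  ext; simp [cylinderAt, and_comm]

/-- A function measurable for the sites in `W` factors through the restriction to `W`. This makes
conditional probabilities constant on cylinders, without null sets. -/
theorem eq_of_measurable_siteEvents {W : Set (ℤ × ℤ)} {f : (ℤ × ℤ → Υ) → ℝ}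
    (hf : Measurable[siteEvents Υ W] f) {ω ω' : ℤ × ℤ → Υ} (h : ∀ u ∈ W, ω' u = ω u) :
    f ω' = f ω := by
  have hle : siteEvents Υ W ≤ MeasurableSpace.comap
      (fun (η : ℤ × ℤ → Υ) (u : W) => η u) MeasurableSpace.pi := by
    refine iSup₂_le fun u hu => ?_
    rintro _ ⟨s, hs, rfl⟩
    exact ⟨(fun η : W → Υ => η ⟨u, hu⟩) ⁻¹' s, measurable_pi_apply _ hs, rfl⟩
  exact (hf.mono hle le_rfl).factorsThrough (funext fun u => h u u.2)

/-- The conditional probability of the letter `y` at the origin, given the sites in `W`. -/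
noncomputable def letterProb (P : Measure (ℤ × ℤ → Υ)) (y : Υ) (W : Set (ℤ × ℤ)) :
    (ℤ × ℤ → Υ) → ℝ :=
  P⟦{ω' : ℤ × ℤ → Υ | ω' 0 = y} | siteEvents Υ W⟧

/-- The conditional information of the letter at the origin given the sites in `W`. The conditional
probabilities are clamped to `[c, 1]`, where they lie almost surely. -/
noncomputable def condInformation (P : Measure (ℤ × ℤ → Υ)) (c : ℝ) (W : Set (ℤ × ℤ))
    (ω : ℤ × ℤ → Υ) : ℝ :=
  -Real.log (max c (min 1 (letterProb P (ω 0) W ω)))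

/-- Each letter appears at the origin with conditional probability above `c`, given any event which
depends on the other sites. -/
def LetterProbAbove (P : Measure (ℤ × ℤ → Υ)) (c : ℝ) : Prop :=
  ∀ A : Set (ℤ × ℤ → Υ), MeasurableSet[siteEvents Υ {(0 : ℤ × ℤ)}ᶜ] A → P A ≠ 0 →
    ∀ y : Υ, c * P.real A < P.real (A ∩ {ω | ω 0 = y})

variable {P : Measure (ℤ × ℤ → Υ)} [IsProbabilityMeasure P]

theorem letterProbAbove_of_forall_cond {c : ℝ}
    (h : ∀ A : Set (ℤ × ℤ → Υ), MeasurableSet[siteEvents Υ {(0 : ℤ × ℤ)}ᶜ] A → P A ≠ 0 →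
      ∀ y : Υ, c < (ProbabilityTheory.cond P A).real {ω | ω 0 = y}) :
    LetterProbAbove P c := by
  intro A hA hPA y
  have h1 := h A hA hPA y
  have hpos : 0 < P.real A := ENNReal.toReal_pos hPA (measure_ne_top _ _)
  rw [Measure.real, cond_apply (cylinderEvents_le_pi _ hA), ENNReal.toReal_mul,
    ENNReal.toReal_inv, ← Measure.real, ← Measure.real] at h1
  rwa [inv_mul_eq_div, lt_div_iff₀ hpos] at h1

variable {c : ℝ}

theorem LetterProbAbove.lt_one [Nonempty Υ] (h : LetterProbAbove P c) : c < 1 := by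
  obtain ⟨y⟩ := ‹Nonempty Υ›
  have := h Set.univ MeasurableSet.univ (by simp) y
  rw [probReal_univ, mul_one] at this
  exact this.trans_le measureReal_le_one

theorem abs_log_sub_log_le (hc : 0 < c) {a b : ℝ} (ha : c ≤ a) (hb : c ≤ b) :
    |Real.log a - Real.log b| ≤ c⁻¹ * |a - b| := by
  have key : ∀ {u v : ℝ}, c ≤ u → c ≤ v → Real.log u - Real.log v ≤ c⁻¹ * |u - v| := by
    intro u v hu hv
    have hu0 := hc.trans_le hu
    have hv0 := hc.trans_le hv
    rw [← Real.log_div hu0.ne' hv0.ne']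
    calc Real.log (u / v) ≤ u / v - 1 := Real.log_le_sub_one_of_pos (div_pos hu0 hv0)
      _ = v⁻¹ * (u - v) := by field_simp
      _ ≤ v⁻¹ * |u - v| := by gcongr; exact le_abs_self _
      _ ≤ c⁻¹ * |u - v| := by gcongr
  refine abs_sub_le_iff.2 ⟨key ha hb, ?_⟩
  rw [abs_sub_comm]
  exact key hb ha

theorem condInformation_nonneg (hc1 : c < 1) (hc : 0 < c) (W : Set (ℤ × ℤ)) (ω : ℤ × ℤ → Υ) :
    0 ≤ condInformation P c W ω := by
  rw [condInformation, neg_nonneg]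
  exact Real.log_nonpos (hc.le.trans (le_max_left _ _)) (max_le hc1.le (min_le_left _ _))

theorem abs_condInformation_le (hc1 : c < 1) (hc : 0 < c) (W : Set (ℤ × ℤ)) (ω : ℤ × ℤ → Υ) :
    |condInformation P c W ω| ≤ -Real.log c := by
  rw [abs_of_nonneg (condInformation_nonneg hc1 hc W ω), condInformation, neg_le_neg_iff]
  exact Real.log_le_log hc (le_max_left _ _)

/-- Clamping is a contraction, and the logarithm is Lipschitz with constant `c⁻¹` above `c`. -/
theorem abs_condInformation_sub_le (hc : 0 < c) (V W : Set (ℤ × ℤ)) (ω : ℤ × ℤ → Υ) :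
    |condInformation P c V ω - condInformation P c W ω|
      ≤ c⁻¹ * |letterProb P (ω 0) V ω - letterProb P (ω 0) W ω| := by
  rw [condInformation, condInformation, neg_sub_neg]
  refine (abs_log_sub_log_le hc (le_max_left _ _) (le_max_left _ _)).trans ?_
  refine mul_le_mul_of_nonneg_left ?_ (inv_nonneg.2 hc.le)
  rw [abs_sub_comm]
  refine (abs_max_sub_max_le_max _ _ _ _).trans (max_le (by simp) ?_)
  exact (abs_min_sub_min_le_max _ _ _ _).trans (max_le (by simp) le_rfl)

section Discrete

variable [DiscreteMeasurableSpace Υ]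

theorem measurableSet_letter (y : Υ) : MeasurableSet {ω : ℤ × ℤ → Υ | ω 0 = y} :=
  (measurable_pi_apply (X := fun _ : ℤ × ℤ => Υ) 0) (measurableSet_singleton y)

theorem aestronglyMeasurable_letter (y : Υ) :
    AEStronglyMeasurable ({ω : ℤ × ℤ → Υ | ω 0 = y}.indicator fun _ => (1 : ℝ)) P :=
  (stronglyMeasurable_const.indicator (measurableSet_letter y)).aestronglyMeasurable

theorem abs_indicator_one_le (s : Set (ℤ × ℤ → Υ)) (ω : ℤ × ℤ → Υ) :
    |s.indicator (fun _ => (1 : ℝ)) ω| ≤ 1 := by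
  by_cases h : ω ∈ s <;> simp [h]

theorem ae_abs_letter_le (y : Υ) :
    ∀ᵐ ω ∂P, |{ω : ℤ × ℤ → Υ | ω 0 = y}.indicator (fun _ => (1 : ℝ)) ω| ≤ 1 :=
  Eventually.of_forall (abs_indicator_one_le _)

theorem integrable_letter (y : Υ) :
    Integrable ({ω : ℤ × ℤ → Υ | ω 0 = y}.indicator fun _ => (1 : ℝ)) P :=
  integrable_of_abs_le (aestronglyMeasurable_letter y) (ae_abs_letter_le y)

theorem integrable_letterProb (y : Υ) (W : Set (ℤ × ℤ)) : Integrable (letterProb P y W) P :=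
  integrable_condExp

theorem measurable_letterProb (y : Υ) (W : Set (ℤ × ℤ)) :
    Measurable[siteEvents Υ W] (letterProb P y W) :=
  stronglyMeasurable_condExp.measurable

theorem setIntegral_letterProb (y : Υ) {W : Set (ℤ × ℤ)} {A : Set (ℤ × ℤ → Υ)}
    (hA : MeasurableSet[siteEvents Υ W] A) :
    ∫ ω in A, letterProb P y W ω ∂P = P.real (A ∩ {ω | ω 0 = y}) := by
  have h := setIntegral_condExp cylinderEvents_le_pi (integrable_letter (P := P) y) hA
  rwa [setIntegral_indicator (measurableSet_letter y), setIntegral_const, smul_eq_mul, mul_one]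
    at h

theorem abs_letterProb_le (y : Υ) (W : Set (ℤ × ℤ)) : ∀ᵐ ω ∂P, |letterProb P y W ω| ≤ 1 :=
  abs_condExp_le (ae_abs_letter_le y)

/-- The event that the bound fails does not involve the origin. If it had positive probability, it
would itself contradict the hypothesis. -/
theorem le_letterProb (h : LetterProbAbove P c) (y : Υ) {W : Set (ℤ × ℤ)} (hW : 0 ∉ W) :
    ∀ᵐ ω ∂P, c ≤ letterProb P y W ω := by
  have hm : siteEvents Υ W ≤ MeasurableSpace.pi := cylinderEvents_le_pi
  have hmeas : MeasurableSet[siteEvents Υ W] {ω | letterProb P y W ω < c} :=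
    (measurable_letterProb y W) measurableSet_Iio
  rw [ae_iff]
  simp only [not_le]
  by_contra hne
  have h1 := h _ (cylinderEvents_mono (Set.subset_compl_singleton_iff.2 hW) _ hmeas) hne y
  have h2 := setIntegral_letterProb (P := P) y hmeas
  have h3 : ∫ ω in {ω | letterProb P y W ω < c}, letterProb P y W ω ∂P
      ≤ ∫ ω in {ω | letterProb P y W ω < c}, c ∂P :=
    setIntegral_mono_on (integrable_letterProb y W).integrableOn (integrable_const _)
      (hm _ hmeas) fun ω hω => le_of_lt hω
  rw [setIntegral_const, smul_eq_mul, h2, mul_comm] at h3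
  exact absurd h1 (not_lt.2 h3)

/-- The origin is adjoined because the letter there is read off from `ω` too. -/
theorem stronglyMeasurable_condInformation [Countable Υ] (W : Set (ℤ × ℤ)) :
    StronglyMeasurable[siteEvents Υ (insert 0 W)] (condInformation P c W) := by
  refine Measurable.stronglyMeasurable ?_
  have h1 : Measurable[siteEvents Υ (insert 0 W)]
      fun ω : ℤ × ℤ → Υ => letterProb P (ω 0) W ω :=
    measurable_eval_of_countable
      (fun y => (measurable_letterProb y W).mono (cylinderEvents_mono (Set.subset_insert _ _))
        le_rfl)
      (measurable_cylinderEvent_apply (Set.mem_insert _ _))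
  exact (Real.measurable_log.comp
    (measurable_const.max (measurable_const.min h1))).neg

theorem aestronglyMeasurable_condInformation [Countable Υ] (W : Set (ℤ × ℤ)) :
    AEStronglyMeasurable (condInformation P c W) P :=
  ((stronglyMeasurable_condInformation W).mono cylinderEvents_le_pi).aestronglyMeasurable

theorem integrable_condInformation [Countable Υ] (hc1 : c < 1) (hc : 0 < c) (W : Set (ℤ × ℤ)) :
    Integrable (condInformation P c W) P :=
  integrable_of_abs_le (aestronglyMeasurable_condInformation W)
    (Eventually.of_forall (abs_condInformation_le hc1 hc W))

/-- The conditional information given the sites in `W` is approximated by the one given finitely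
many of these sites, uniformly in `W`. -/
theorem exists_box_integral_condInformation_sub_le [Finite Υ] (hzero : StrongZeroOneLaw P)
    (hc1 : c < 1) (hc : 0 < c) {δ : ℝ} (hδ : 0 < δ) :
    ∃ n : ℕ, ∀ W : Set (ℤ × ℤ),
      ∫ ω, |condInformation P c W ω - condInformation P c (W ∩ box n) ω| ∂P ≤ δ := by
  have := Fintype.ofFinite Υ
  -- The factor `c` absorbs the Lipschitz constant, and the denominator the sum over all letters,
  -- which replaces the random letter at the origin.
  set η : ℝ := c * δ / (Fintype.card Υ + 1) with hη
  have hη0 : 0 < η := by positivity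
  have hex := fun y : Υ => exists_box_condSecondMoment_sub_le hzero
    (aestronglyMeasurable_letter (P := P) y) (ae_abs_letter_le y) (pow_pos hη0 2)
  choose r hr using hex
  refine ⟨Finset.univ.sup r, fun W => ?_⟩
  set B := W ∩ (box (Finset.univ.sup r) : Set (ℤ × ℤ)) with hB
  have hy : ∀ y, ∫ ω, |letterProb P y W ω - letterProb P y B ω| ∂P ≤ η := by
    intro y
    have hi : Integrable (fun ω => letterProb P y W ω - letterProb P y B ω) P :=
      (integrable_letterProb y W).sub (integrable_letterProb y B)
    have hbd : ∀ᵐ ω ∂P, |(|letterProb P y W ω - letterProb P y B ω|)| ≤ 1 + 1 := by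
      filter_upwards [abs_letterProb_le (P := P) y W, abs_letterProb_le (P := P) y B] with ω h1 h2
      rw [abs_abs]
      exact (abs_sub _ _).trans (add_le_add h1 h2)
    have h1 := sq_integral_le hi.abs.aestronglyMeasurable hbd
    simp_rw [sq_abs] at h1
    have h2 : ∫ ω, (letterProb P y W ω - letterProb P y B ω) ^ 2 ∂P = _ :=
      integral_sq_condExp_siteEvents_sub (P := P) (aestronglyMeasurable_letter y)
      (ae_abs_letter_le y) (Set.inter_subset_left : B ⊆ W)
    have h3 := hr y W
    have h4 := condSecondMoment_mono (P := P) (aestronglyMeasurable_letter y) (ae_abs_letter_le y)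
      (show W ∩ (box (r y) : Set (ℤ × ℤ)) ⊆ B from Set.inter_subset_inter_right _
        (by exact_mod_cast box_mono (Finset.le_sup (Finset.mem_univ y))))
    exact le_of_sq_le_sq (by linarith) hη0.le
  have hsum : Integrable (fun ω => ∑ y, |letterProb P y W ω - letterProb P y B ω|) P :=
    integrable_finsetSum _ fun y _ =>
      ((integrable_letterProb y W).sub (integrable_letterProb y B)).abs
  calc ∫ ω, |condInformation P c W ω - condInformation P c B ω| ∂P
      ≤ ∫ ω, c⁻¹ * ∑ y, |letterProb P y W ω - letterProb P y B ω| ∂P := by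
        refine integral_mono ((integrable_condInformation hc1 hc W).sub
          (integrable_condInformation hc1 hc B)).abs (hsum.const_mul _) fun ω => ?_
        refine (abs_condInformation_sub_le hc W B ω).trans ?_
        change _ ≤ c⁻¹ * _
        gcongr
        exact Finset.single_le_sum (f := fun y => |letterProb P y W ω - letterProb P y B ω|)
          (fun y _ => abs_nonneg _) (Finset.mem_univ (ω 0))
    _ = c⁻¹ * ∑ y, ∫ ω, |letterProb P y W ω - letterProb P y B ω| ∂P := by
        rw [integral_const_mul, integral_finsetSum]
        exact fun y _ => ((integrable_letterProb y W).sub (integrable_letterProb y B)).abs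
    _ ≤ c⁻¹ * ∑ _y : Υ, η := by gcongr with y; exact hy y
    _ = c⁻¹ * (Fintype.card Υ * (c * δ / (Fintype.card Υ + 1))) := by simp [hη]
    _ = δ * (Fintype.card Υ / (Fintype.card Υ + 1)) := by field_simp
    _ ≤ δ * 1 := by
        gcongr
        rw [div_le_one (by positivity)]
        linarith
    _ = δ := mul_one δ

/-- The mean conditional information is the conditional entropy. -/
theorem integral_condInformation [Fintype Υ] (h : LetterProbAbove P c)
    (hc1 : c < 1) (hc : 0 < c) {W : Set (ℤ × ℤ)} (hW : 0 ∉ W) :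
    ∫ ω, condInformation P c W ω ∂P = conditionalEntropy P W := by
  set L : Υ → (ℤ × ℤ → Υ) → ℝ := fun y ω => -Real.log (max c (min 1 (letterProb P y W ω)))
    with hL
  have hLm : ∀ y, StronglyMeasurable[siteEvents Υ W] (L y) := fun y =>
    (Real.measurable_log.comp (measurable_const.max
      (measurable_const.min stronglyMeasurable_condExp.measurable))).neg.stronglyMeasurable
  have hLb : ∀ y ω, |L y ω| ≤ -Real.log c := by
    intro y ω
    have h1 : 0 ≤ L y ω := neg_nonneg.2
      (Real.log_nonpos (hc.le.trans (le_max_left _ _)) (max_le hc1.le (min_le_left _ _)))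
    rw [abs_of_nonneg h1]
    exact neg_le_neg (Real.log_le_log hc (le_max_left _ _))
  have hLm' : ∀ y, AEStronglyMeasurable[MeasurableSpace.pi] (L y) P := fun y =>
    ((hLm y).mono cylinderEvents_le_pi).aestronglyMeasurable
  have e1 : ∀ ω, condInformation P c W ω
      = ∑ y, L y ω * {ω : ℤ × ℤ → Υ | ω 0 = y}.indicator (fun _ => (1 : ℝ)) ω := by
    intro ω
    rw [Finset.sum_eq_single (ω 0)]
    · simp [hL, condInformation]
    · intro y _ hy
      simp [Ne.symm hy]
    · simp
  simp_rw [e1]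
  rw [integral_finsetSum _ fun y _ => (integrable_letter y).bdd_mul (hLm' y)
    (Eventually.of_forall (hLb y)), conditionalEntropy]
  -- `L y` depends only on the sites in `W`, so the indicator may be replaced by its conditional
  -- expectation.
  have e2 : ∀ y, ∫ ω, L y ω * {ω : ℤ × ℤ → Υ | ω 0 = y}.indicator (fun _ => (1 : ℝ)) ω ∂P
      = ∫ ω, L y ω * letterProb P y W ω ∂P := fun y =>
    (integral_mul_condExp cylinderEvents_le_pi (integrable_letter y) (hLm y)
      (Eventually.of_forall (hLb y))).symm
  simp_rw [e2]
  rw [← integral_finsetSum _ fun y _ => (integrable_letterProb y W).bdd_mul (hLm' y)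
    (Eventually.of_forall (hLb y))]
  refine integral_congr_ae ?_
  have h1 : ∀ᵐ ω ∂P, ∀ y, c ≤ letterProb P y W ω := ae_all_iff.2 fun y => le_letterProb h y hW
  have h2 : ∀ᵐ ω ∂P, ∀ y, |letterProb P y W ω| ≤ 1 := ae_all_iff.2 fun y => abs_letterProb_le y W
  filter_upwards [h1, h2] with ω h1 h2
  refine Finset.sum_congr rfl fun y _ => ?_
  simp only [hL, Real.negMulLog]
  rw [min_eq_right (le_of_abs_le (h2 y)), max_eq_right (h1 y)]
  simp only [letterProb]
  ring

/-- The conditional probability is constant on the cylinder, so integrating it there is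
multiplication. The identity holds at every `ω`, not just almost everywhere. -/
theorem letterProb_mul_cylinderAt (U : Finset (ℤ × ℤ)) (ω : ℤ × ℤ → Υ) :
    letterProb P (ω 0) U ω * P.real (cylinderAt U ω) = P.real (cylinderAt (insert 0 U) ω) := by
  rw [cylinderAt_insert, ← setIntegral_letterProb _ (measurableSet_cylinderAt U ω), mul_comm,
    ← smul_eq_mul, ← setIntegral_const]
  refine setIntegral_congr_fun (cylinderEvents_le_pi _ (measurableSet_cylinderAt U ω))
    fun ω' hω' => ?_
  exact (eq_of_measurable_siteEvents (W := (U : Set (ℤ × ℤ)))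
    stronglyMeasurable_condExp.measurable hω').symm

theorem measureReal_cylinderAt_image_add (hstat : IsStationaryField P) (U : Finset (ℤ × ℤ))
    (w : ℤ × ℤ) (ω : ℤ × ℤ → Υ) :
    P.real (cylinderAt (U.image (· + w)) ω) = P.real (cylinderAt U (shift w ω)) := by
  have h : cylinderAt (U.image (· + w)) ω = shift w ⁻¹' cylinderAt U (shift w ω) := by
    ext ω'; simp only [cylinderAt, shift, Finset.forall_mem_image, Set.mem_preimage]; rfl
  rw [h, (hstat w).measureReal_preimage
    (cylinderEvents_le_pi _ (measurableSet_cylinderAt U _)).nullMeasurableSet]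

theorem lt_measureReal_cylinderAt_insert (h : LetterProbAbove P c) {U : Finset (ℤ × ℤ)}
    (hU : 0 ∉ U) {ω : ℤ × ℤ → Υ} (hω : 0 < P.real (cylinderAt U ω)) :
    c * P.real (cylinderAt U ω) < P.real (cylinderAt (insert 0 U) ω) := by
  rw [cylinderAt_insert]
  refine h _ (cylinderEvents_mono ?_ _ (measurableSet_cylinderAt U ω)) ?_ _
  · exact Set.subset_compl_singleton_iff.2 (by simpa using hU)
  · exact fun h0 => hω.ne' (by simp [Measure.real, h0])

theorem image_sub_image_add (V : Finset (ℤ × ℤ)) (v : ℤ × ℤ) :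
    (V.image (· - v)).image (· + v) = V := by
  simp [Finset.image_image, Function.comp_def]

theorem insert_zero_image_add (V : Finset (ℤ × ℤ)) (v : ℤ × ℤ) :
    (insert 0 (V.image (· - v))).image (· + v) = insert v V := by
  rw [Finset.image_insert, image_sub_image_add, zero_add]

theorem zero_notMem_image_sub {V : Finset (ℤ × ℤ)} {v : ℤ × ℤ} (hv : v ∉ V) :
    (0 : ℤ × ℤ) ∉ V.image (· - v) := by
  simp only [Finset.mem_image, not_exists, not_and, sub_eq_zero]
  rintro u hu rfl
  exact hv hu

/-- Each new site, moved to the origin by stationarity, multiplies the probability by more than `c`.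
-/
theorem measureReal_cylinderAt_pos (hstat : IsStationaryField P) (h : LetterProbAbove P c)
    (hc : 0 < c) (V : Finset (ℤ × ℤ)) (ω : ℤ × ℤ → Υ) : 0 < P.real (cylinderAt V ω) := by
  induction V using Finset.induction_on with
  | empty => simp [cylinderAt]
  | insert v V hv ih =>
    rw [← image_sub_image_add V v, measureReal_cylinderAt_image_add hstat] at ih
    rw [← insert_zero_image_add, measureReal_cylinderAt_image_add hstat]
    exact (mul_pos hc ih).trans
      (lt_measureReal_cylinderAt_insert h (zero_notMem_image_sub hv) ih)

/-- The chain rule for the information, adding one site. -/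
theorem information_insert (hstat : IsStationaryField P) (h : LetterProbAbove P c) (hc : 0 < c)
    {V : Finset (ℤ × ℤ)} {v : ℤ × ℤ} (hv : v ∉ V) (ω : ℤ × ℤ → Υ) :
    information P (insert v V) ω = information P V ω
      + condInformation P c ((· - v) '' (V : Set (ℤ × ℤ))) (shift v ω) := by
  set U := V.image (· - v) with hU
  have hcoe : ((· - v) '' (V : Set (ℤ × ℤ))) = (U : Set (ℤ × ℤ)) := by simp [hU]
  have h0 : (0 : ℤ × ℤ) ∉ U := zero_notMem_image_sub hv
  have e1 : P.real (cylinderAt V ω) = P.real (cylinderAt U (shift v ω)) := by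
    rw [← measureReal_cylinderAt_image_add hstat, image_sub_image_add]
  have e2 : P.real (cylinderAt (insert v V) ω)
      = P.real (cylinderAt (insert 0 U) (shift v ω)) := by
    rw [← measureReal_cylinderAt_image_add hstat, insert_zero_image_add]
  have hp := measureReal_cylinderAt_pos hstat h hc U (shift v ω)
  have e3 := letterProb_mul_cylinderAt (P := P) U (shift v ω)
  have hlt := lt_measureReal_cylinderAt_insert h h0 hp
  rw [← e3] at hlt
  -- As all cylinders have positive probability, the clamp in `condInformation` is inactive at every
  -- `ω`.
  have h1 : c < letterProb P (shift v ω 0) U (shift v ω) := lt_of_mul_lt_mul_right hlt hp.le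
  have h2 : letterProb P (shift v ω 0) U (shift v ω) ≤ 1 := by
    refine le_of_mul_le_mul_right ?_ hp
    rw [e3, one_mul, cylinderAt_insert]
    exact measureReal_mono Set.inter_subset_left
  change -Real.log (P.real (cylinderAt (insert v V) ω)) = -Real.log (P.real (cylinderAt V ω)) + _
  rw [hcoe, condInformation, min_eq_right h2, max_eq_right h1.le, e1, e2, ← e3,
    Real.log_mul (hc.trans h1).ne' hp.ne']
  ring

/-- The sites visited by the path `v` before time `i`, seen from the site visited at time `i`. -/
def pathPast (v : ℕ → ℤ × ℤ) (i : ℕ) : Set (ℤ × ℤ) := (fun j => v j - v i) '' Set.Iio i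

/-- The chain rule for the information along a path without self-intersections. -/
theorem information_image_range (hstat : IsStationaryField P) (h : LetterProbAbove P c)
    (hc : 0 < c) {v : ℕ → ℤ × ℤ} (hv : v.Injective) (N : ℕ) (ω : ℤ × ℤ → Υ) :
    information P ((Finset.range N).image v) ω
      = ∑ i ∈ Finset.range N, condInformation P c (pathPast v i) (shift (v i) ω) := by
  induction N with
  | zero => simp [information]
  | succ N ih =>
    have hN : v N ∉ (Finset.range N).image v := by
      simp only [Finset.mem_image, Finset.mem_range, not_exists, not_and]
      intro j hj hjN
      exact hj.ne (hv hjN)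
    have hset : pathPast v N =
        (· - v N) '' (((Finset.range N).image v : Finset _) : Set (ℤ × ℤ)) := by
      rw [Finset.coe_image, Set.image_image, Finset.coe_range]
      rfl
    rw [Finset.range_add_one, Finset.image_insert, information_insert hstat h hc hN, ih,
      Finset.sum_insert (by simp), add_comm, hset]

end Discrete

end Information

/-! ### Law of large numbers along paths without self-intersections. -/

theorem sq_integral_abs_sum_le {Ω : Type*} {m0 : MeasurableSpace Ω} {μ : Measure Ω}
    [IsProbabilityMeasure μ] {ι : Type*} (s : Finset ι) {X : ι → Ω → ℝ} {K : ℝ}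
    (hX : ∀ i, AEStronglyMeasurable (X i) μ) (hK : ∀ i ω, |X i ω| ≤ K) :
    (∫ ω, |∑ i ∈ s, X i ω| ∂μ) ^ 2 ≤ ∑ i ∈ s, ∑ j ∈ s, ∫ ω, X i ω * X j ω ∂μ := by
  have hi : ∀ i j, Integrable (fun ω => X i ω * X j ω) μ := fun i j =>
    (integrable_of_abs_le (hX j) (Eventually.of_forall (hK j))).bdd_mul (hX i)
      (Eventually.of_forall (hK i))
  have hsm : AEStronglyMeasurable (fun ω => |∑ i ∈ s, X i ω|) μ := by
    have := (Finset.aestronglyMeasurable_fun_sum s fun i _ => hX i).norm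
    simpa only [Real.norm_eq_abs] using this
  have hbd : ∀ᵐ ω ∂μ, |(|∑ i ∈ s, X i ω|)| ≤ ∑ _i ∈ s, K := Eventually.of_forall fun ω => by
    rw [abs_abs]
    exact (Finset.abs_sum_le_sum_abs _ _).trans (Finset.sum_le_sum fun i _ => hK i ω)
  refine (sq_integral_le hsm hbd).trans (le_of_eq ?_)
  simp_rw [sq_abs, sq, Finset.sum_mul_sum]
  rw [integral_finsetSum _ fun i _ => integrable_finsetSum _ fun j _ => hi i j]
  exact Finset.sum_congr rfl fun i _ => integral_finsetSum _ fun j _ => hi i j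

section Path

variable {Υ : Type*} [MeasurableSpace Υ] {P : Measure (ℤ × ℤ → Υ)} [IsProbabilityMeasure P]

theorem shift_sub_shift (u v : ℤ × ℤ) (ω : ℤ × ℤ → Υ) : shift (u - v) (shift v ω) = shift u ω := by
  funext x
  simp [shift, add_assoc]

/-- The covariances of finitely many local functions, translated, are small off a finite set. -/
theorem exists_finset_cov_condInformation_le [Finite Υ] [DiscreteMeasurableSpace Υ]
    (hstat : IsStationaryField P) (hzero : StrongZeroOneLaw P) {c : ℝ} (hc1 : c < 1) (hc : 0 < c)
    (B : Finset (ℤ × ℤ)) {η : ℝ} (hη : 0 < η) :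
    ∃ S : Finset (ℤ × ℤ), ∀ U ⊆ B, ∀ V ⊆ B, ∀ w ∉ S,
      |∫ ω, condInformation P c U (shift w ω) * condInformation P c V ω ∂P
        - (∫ ω, condInformation P c U ω ∂P) * ∫ ω, condInformation P c V ω ∂P| ≤ η := by
  have hex : ∀ U V : Finset (ℤ × ℤ), ∃ S : Finset (ℤ × ℤ), ∀ w ∉ S,
      |∫ ω, condInformation P c U (shift w ω) * condInformation P c V ω ∂P
        - (∫ ω, condInformation P c U ω ∂P) * ∫ ω, condInformation P c V ω ∂P| ≤ η := by
    intro U V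
    have hU := stronglyMeasurable_condInformation (P := P) (c := c) (U : Set (ℤ × ℤ))
    rw [← Finset.coe_insert] at hU
    exact exists_finset_abs_cov_shift_le hstat hzero (aestronglyMeasurable_condInformation _)
      (Eventually.of_forall (abs_condInformation_le hc1 hc V)) hU
      (abs_condInformation_le hc1 hc U) hη
  choose S hS using hex
  refine ⟨(B.powerset ×ˢ B.powerset).biUnion fun p => S p.1 p.2, fun U hU V hV w hw => ?_⟩
  refine hS U V w fun hmem => hw (Finset.mem_biUnion.2 ⟨(U, V), ?_, hmem⟩)
  simp [hU, hV]

/-- This bounds the pairs of sites whose covariance is not small. It is where self-avoidance of the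
path matters. -/
theorem card_filter_sub_mem_le {v : ℕ → ℤ × ℤ} (hv : v.Injective) (S : Finset (ℤ × ℤ)) (N i : ℕ) :
    ((Finset.range N).filter fun j => v i - v j ∈ S).card ≤ S.card := by
  refine Finset.card_le_card_of_injOn (fun j => v i - v j) (fun j hj => ?_) fun j _ k _ h => ?_
  · exact (Finset.mem_filter.1 hj).2
  · exact hv (sub_right_injective h)

/-- The law of large numbers for the conditional informations along a path without
self-intersections, given the past of the path. It holds uniformly for all such paths. -/
theorem exists_forall_integral_abs_sum_condInformation_le [Finite Υ] [DiscreteMeasurableSpace Υ]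
    (hstat : IsStationaryField P) (hzero : StrongZeroOneLaw P) {c : ℝ} (hc1 : c < 1) (hc : 0 < c)
    {δ : ℝ} (hδ : 0 < δ) :
    ∃ N₀ : ℕ, ∀ v : ℕ → ℤ × ℤ, v.Injective → ∀ N ≥ N₀,
      ∫ ω, |∑ i ∈ Finset.range N, (condInformation P c (pathPast v i) (shift (v i) ω)
        - ∫ ω', condInformation P c (pathPast v i) ω' ∂P)| ∂P ≤ δ * N := by
  obtain ⟨r, hr⟩ := exists_box_integral_condInformation_sub_le hzero hc1 hc
    (show 0 < δ / 4 by positivity)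
  obtain ⟨S, hS⟩ := exists_finset_cov_condInformation_le hstat hzero hc1 hc (box r)
    (show 0 < δ ^ 2 / 8 by positivity)
  set K : ℝ := -Real.log c with hK
  -- For `N ≥ N₀` the close pairs contribute no more to the variance than the bound `δ ^ 2 / 8` on
  -- the distant ones, which gives `δ / 2`. Truncating the informations and their means costs `δ /
  -- 4` each.
  obtain ⟨N₀, hN₀⟩ := exists_nat_ge (8 * S.card * (2 * K * (2 * K)) / δ ^ 2)
  refine ⟨N₀, fun v hv N hN => ?_⟩
  classical
  set g : Set (ℤ × ℤ) → (ℤ × ℤ → Υ) → ℝ := condInformation P c with hg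
  set e : Set (ℤ × ℤ) → ℝ := fun W => ∫ ω, g W ω ∂P with he
  -- The truncated pasts are subsets of one fixed box, so the set `S` serves all paths.
  set U : ℕ → Finset (ℤ × ℤ) := fun i => (box r).filter (· ∈ pathPast v i) with hU
  have hUcoe : ∀ i, pathPast v i ∩ box r = U i := by
    intro i; ext p; simp [hU, and_comm]
  have hUsub : ∀ i, U i ⊆ box r := fun i => Finset.filter_subset _ _
  have hgm : ∀ W, AEStronglyMeasurable (g W) P := aestronglyMeasurable_condInformation
  have hgK : ∀ W ω, |g W ω| ≤ K := abs_condInformation_le hc1 hc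
  have hgi : ∀ W, Integrable (g W) P := integrable_condInformation hc1 hc
  have hgs : ∀ W w, AEStronglyMeasurable (fun ω => g W (shift w ω)) P := fun W w =>
    (hgm W).comp_measurePreserving (hstat w)
  have hgsi : ∀ W w, Integrable (fun ω => g W (shift w ω)) P := fun W w =>
    integrable_of_abs_le (hgs W w) (Eventually.of_forall fun _ => hgK _ _)
  have heK : ∀ W, |e W| ≤ K := fun W => by
    have := norm_integral_le_of_norm_le_const (μ := P) (f := g W) (C := K)
      (Eventually.of_forall (hgK W))
    rwa [probReal_univ, mul_one] at this
  set X : ℕ → (ℤ × ℤ → Υ) → ℝ := fun i ω => g (U i) (shift (v i) ω) - e (U i) with hX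
  have hXm : ∀ i, AEStronglyMeasurable (X i) P := fun i =>
    (hgs _ _).sub aestronglyMeasurable_const
  have hXK : ∀ i ω, |X i ω| ≤ 2 * K := fun i ω => by
    refine (abs_sub _ _).trans ?_
    rw [two_mul]
    exact add_le_add (hgK _ _) (heK _)
  have hcov : ∀ i j, ∫ ω, X i ω * X j ω ∂P
      ≤ δ ^ 2 / 8 + if v i - v j ∈ S then 2 * K * (2 * K) else 0 := by
    intro i j
    split_ifs with hij
    · have h1 : ∀ᵐ ω ∂P, ‖X i ω * X j ω‖ ≤ 2 * K * (2 * K) := Eventually.of_forall fun ω => by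
        rw [norm_mul]
        exact mul_le_mul (hXK i ω) (hXK j ω) (norm_nonneg _) ((abs_nonneg _).trans (hXK i ω))
      have h2 := norm_integral_le_of_norm_le_const h1
      rw [probReal_univ, mul_one] at h2
      have h3 := (le_abs_self _).trans h2
      have : 0 < δ ^ 2 / 8 := by positivity
      linarith
    · have h1 := hS (U i) (hUsub i) (U j) (hUsub j) _ hij
      have h2 : ∫ ω, g (U i) (shift (v i) ω) * g (U j) (shift (v j) ω) ∂P
          = ∫ ω, g (U i) (shift (v i - v j) ω) * g (U j) ω ∂P := by
        rw [← integral_comp_shift hstat (v j)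
          (F := fun ω => g (U i) (shift (v i - v j) ω) * g (U j) ω) ((hgs _ _).mul (hgm _))]
        simp_rw [shift_sub_shift]
      have h3 : ∫ ω, X i ω * X j ω ∂P
          = ∫ ω, g (U i) (shift (v i) ω) * g (U j) (shift (v j) ω) ∂P - e (U i) * e (U j) := by
        have hexp : ∀ ω, X i ω * X j ω = g (U i) (shift (v i) ω) * g (U j) (shift (v j) ω)
            - e (U j) * g (U i) (shift (v i) ω)
            - (e (U i) * g (U j) (shift (v j) ω) - e (U i) * e (U j)) := fun ω => by
          simp only [hX]; ring
        have i1 : Integrable (fun ω => g (U i) (shift (v i) ω) * g (U j) (shift (v j) ω)) P :=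
          (hgsi _ _).bdd_mul (hgs _ _) (Eventually.of_forall fun _ => hgK _ _)
        have i2 : Integrable (fun ω => e (U j) * g (U i) (shift (v i) ω)) P :=
          (hgsi _ _).const_mul _
        have i3 : Integrable (fun ω => e (U i) * g (U j) (shift (v j) ω)) P :=
          (hgsi _ _).const_mul _
        have i4 : Integrable (fun ω => g (U i) (shift (v i) ω) * g (U j) (shift (v j) ω)
            - e (U j) * g (U i) (shift (v i) ω)) P := i1.sub i2
        have i5 : Integrable
            (fun ω => e (U i) * g (U j) (shift (v j) ω) - e (U i) * e (U j)) P :=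
          i3.sub (integrable_const _)
        simp_rw [hexp]
        rw [integral_sub i4 i5, integral_sub i1 i2, integral_sub i3 (integrable_const _),
          integral_const_mul, integral_const_mul, integral_comp_shift hstat _ (hgm _),
          integral_comp_shift hstat _ (hgm _), integral_const, probReal_univ, one_smul]
        simp only [he]
        ring
      rw [h3, h2, add_zero]
      exact (le_abs_self _).trans h1
  have hvar : (∫ ω, |∑ i ∈ Finset.range N, X i ω| ∂P) ^ 2 ≤ (δ / 2 * N) ^ 2 := by
    refine (sq_integral_abs_sum_le _ hXm hXK).trans ?_
    calc ∑ i ∈ Finset.range N, ∑ j ∈ Finset.range N, ∫ ω, X i ω * X j ω ∂P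
        ≤ ∑ _i ∈ Finset.range N, (N * (δ ^ 2 / 8) + S.card * (2 * K * (2 * K))) := by
          refine Finset.sum_le_sum fun i _ => ?_
          refine (Finset.sum_le_sum fun j _ => hcov i j).trans ?_
          rw [Finset.sum_add_distrib, ← Finset.sum_filter, Finset.sum_const, Finset.sum_const,
            Finset.card_range, nsmul_eq_mul, nsmul_eq_mul]
          have h1 : (((Finset.range N).filter fun j => v i - v j ∈ S).card : ℝ) ≤ S.card := by
            exact_mod_cast card_filter_sub_mem_le hv S N i
          have h2 : 0 ≤ 2 * K * (2 * K) := mul_self_nonneg _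
          gcongr
      _ = N * (N * (δ ^ 2 / 8) + S.card * (2 * K * (2 * K))) := by
          rw [Finset.sum_const, Finset.card_range, nsmul_eq_mul]
      _ ≤ N * (N * (δ ^ 2 / 8) + N * (δ ^ 2 / 8)) := by
          have h1 : (N₀ : ℝ) ≤ N := by exact_mod_cast hN
          have h2 := hN₀.trans h1
          rw [div_le_iff₀ (by positivity)] at h2
          refine mul_le_mul_of_nonneg_left ?_ (Nat.cast_nonneg N)
          linarith
      _ = (δ / 2 * N) ^ 2 := by ring
  have hX1 : ∫ ω, |∑ i ∈ Finset.range N, X i ω| ∂P ≤ δ / 2 * N :=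
    le_of_sq_le_sq hvar (by positivity)
  have hW : ∀ i, ∫ ω, |g (pathPast v i) ω - g (U i) ω| ∂P ≤ δ / 4 := fun i => by
    have := hr (pathPast v i)
    rwa [hUcoe] at this
  have heW : ∀ i, |e (pathPast v i) - e (U i)| ≤ δ / 4 := fun i => by
    rw [he]
    simp only
    rw [← integral_sub (hgi _) (hgi _)]
    exact (abs_integral_le_integral_abs).trans (hW i)
  have hWi : ∀ i, Integrable
      (fun ω => |g (pathPast v i) (shift (v i) ω) - g (U i) (shift (v i) ω)|) P := fun i =>
    ((hgsi _ _).sub (hgsi _ _)).abs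
  have hpt : ∀ ω, |∑ i ∈ Finset.range N, (g (pathPast v i) (shift (v i) ω) - e (pathPast v i))|
      ≤ |∑ i ∈ Finset.range N, X i ω| + ∑ i ∈ Finset.range N,
        (|g (pathPast v i) (shift (v i) ω) - g (U i) (shift (v i) ω)| + δ / 4) := by
    intro ω
    have h1 : ∑ i ∈ Finset.range N, (g (pathPast v i) (shift (v i) ω) - e (pathPast v i))
        = ∑ i ∈ Finset.range N, X i ω + ∑ i ∈ Finset.range N,
          ((g (pathPast v i) (shift (v i) ω) - g (U i) (shift (v i) ω))
            - (e (pathPast v i) - e (U i))) := by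
      rw [← Finset.sum_add_distrib]
      refine Finset.sum_congr rfl fun i _ => ?_
      simp only [hX]; ring
    rw [h1]
    refine (abs_add_le _ _).trans (add_le_add le_rfl ?_)
    refine (Finset.abs_sum_le_sum_abs _ _).trans (Finset.sum_le_sum fun i _ => ?_)
    exact (abs_sub _ _).trans (add_le_add le_rfl (heW i))
  have hXi : Integrable (fun ω => |∑ i ∈ Finset.range N, X i ω|) P :=
    (integrable_finsetSum _ fun i _ => (hgsi _ _).sub (integrable_const _)).abs
  have hsi : Integrable (fun ω => ∑ i ∈ Finset.range N,
      (|g (pathPast v i) (shift (v i) ω) - g (U i) (shift (v i) ω)| + δ / 4)) P :=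
    integrable_finsetSum _ fun i _ => (hWi i).add (integrable_const _)
  calc ∫ ω, |∑ i ∈ Finset.range N, (g (pathPast v i) (shift (v i) ω) - e (pathPast v i))| ∂P
      ≤ ∫ ω, (|∑ i ∈ Finset.range N, X i ω| + ∑ i ∈ Finset.range N,
        (|g (pathPast v i) (shift (v i) ω) - g (U i) (shift (v i) ω)| + δ / 4)) ∂P :=
        integral_mono_of_nonneg (Eventually.of_forall fun _ => abs_nonneg _) (hXi.add hsi)
          (Eventually.of_forall hpt)
    _ = ∫ ω, |∑ i ∈ Finset.range N, X i ω| ∂P + ∑ i ∈ Finset.range N,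
        (∫ ω, |g (pathPast v i) ω - g (U i) ω| ∂P + δ / 4) := by
        have hWi' : ∀ i, Integrable (fun ω =>
            |g (pathPast v i) (shift (v i) ω) - g (U i) (shift (v i) ω)| + δ / 4) P := fun i =>
          (hWi i).add (integrable_const _)
        rw [integral_add hXi hsi, integral_finsetSum _ fun i _ => hWi' i]
        congr 1
        refine Finset.sum_congr rfl fun i _ => ?_
        rw [integral_add (hWi i) (integrable_const _), integral_const, probReal_univ, one_smul,
          integral_comp_shift hstat (v i) (F := fun ω => |g (pathPast v i) ω - g (U i) ω|)
            ((hgi _).sub (hgi _)).abs.aestronglyMeasurable]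
    _ ≤ δ / 2 * N + ∑ _i ∈ Finset.range N, (δ / 4 + δ / 4) := by
        gcongr with i _
        exact hW i
    _ = δ * N := by rw [Finset.sum_const, Finset.card_range, nsmul_eq_mul]; ring

end Path

/-! ### Bounded discrepancy for rotations of the circle. -/

section Equidistribution

/-- The sums of `f` along all orbits of the rotation by `l` of the circle `ℝ / ℤ` differ by a
bounded amount from the corresponding multiples of the integral of `f`. -/
def BoundedDiscrepancy (l : ℝ) (f : ℝ → ℝ) : Prop :=
  IntervalIntegrable f volume 0 1 ∧ ∃ C : ℝ, ∀ (β : ℝ) (N : ℕ),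
    |∑ i ∈ Finset.range N, f (Int.fract (l * i + β)) - N * ∫ t in (0 : ℝ)..1, f t| ≤ C

variable {l : ℝ} {f g : ℝ → ℝ}

theorem BoundedDiscrepancy.add (hf : BoundedDiscrepancy l f) (hg : BoundedDiscrepancy l g) :
    BoundedDiscrepancy l fun t => f t + g t := by
  obtain ⟨hfi, C, hC⟩ := hf
  obtain ⟨hgi, D, hD⟩ := hg
  refine ⟨hfi.add hgi, C + D, fun β N => ?_⟩
  rw [Finset.sum_add_distrib, intervalIntegral.integral_add hfi hgi, mul_add, add_sub_add_comm]
  exact (abs_add_le _ _).trans (add_le_add (hC β N) (hD β N))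

theorem BoundedDiscrepancy.const_mul (hf : BoundedDiscrepancy l f) (a : ℝ) :
    BoundedDiscrepancy l fun t => a * f t := by
  obtain ⟨hfi, C, hC⟩ := hf
  refine ⟨hfi.const_mul a, |a| * C, fun β N => ?_⟩
  rw [← Finset.mul_sum, intervalIntegral.integral_const_mul, mul_left_comm, ← mul_sub, abs_mul]
  exact mul_le_mul_of_nonneg_left (hC β N) (abs_nonneg a)

theorem boundedDiscrepancy_const (l a : ℝ) : BoundedDiscrepancy l fun _ => a :=
  ⟨intervalIntegrable_const, 0, fun β N => by simp⟩

/-- Fractional parts never take the value 1, and the integral does not see this point. -/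
theorem BoundedDiscrepancy.congr (hf : BoundedDiscrepancy l f)
    (h : ∀ t ∈ Set.Ico (0 : ℝ) 1, f t = g t) : BoundedDiscrepancy l g := by
  obtain ⟨hfi, C, hC⟩ := hf
  have hae : ∀ᵐ t ∂(volume : Measure ℝ), t ∈ Set.uIoc (0 : ℝ) 1 → f t = g t := by
    have h1 : ∀ᵐ t ∂(volume : Measure ℝ), t ≠ 1 := by simp [ae_iff]
    filter_upwards [h1] with t ht htI
    rw [Set.uIoc_of_le zero_le_one] at htI
    exact h t ⟨htI.1.le, lt_of_le_of_ne htI.2 ht⟩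
  refine ⟨hfi.congr_ae ((ae_restrict_iff' measurableSet_uIoc).2 hae), C, fun β N => ?_⟩
  rw [← intervalIntegral.integral_congr_ae hae]
  convert hC β N using 4 with i _
  exact (h _ ⟨Int.fract_nonneg _, Int.fract_lt_one _⟩).symm

theorem integral_floor_add (κ : ℝ) : ∫ t in (0 : ℝ)..1, (⌊t + κ⌋ : ℝ) = κ := by
  have hper : Function.Periodic (fun t : ℝ => Int.fract t) 1 := fun t => Int.fract_add_one t
  have hfi : ∀ a b : ℝ, IntervalIntegrable (fun t : ℝ => Int.fract t) volume a b := fun a b => by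
    refine (intervalIntegrable_const (c := (1 : ℝ))).mono_fun
      measurable_fract.aestronglyMeasurable (Eventually.of_forall fun t => ?_)
    simp only [norm_one, Real.norm_eq_abs, Int.abs_fract]
    exact (Int.fract_lt_one t).le
  have h01 : ∫ t in (0 : ℝ)..1, Int.fract t = 1 / 2 := by
    have : ∫ t in (0 : ℝ)..1, Int.fract t = ∫ t in (0 : ℝ)..1, t := by
      refine intervalIntegral.integral_congr_ae ?_
      have h1 : ∀ᵐ t ∂(volume : Measure ℝ), t ≠ 1 := by simp [ae_iff]
      filter_upwards [h1] with t ht htI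
      rw [Set.uIoc_of_le zero_le_one] at htI
      exact Int.fract_eq_self.2 ⟨htI.1.le, lt_of_le_of_ne htI.2 ht⟩
    rw [this, integral_id]
    norm_num
  have hsum : ∫ t in κ..(κ + 1), Int.fract t = 1 / 2 := by
    have := hper.intervalIntegral_add_eq κ 0
    rw [this, zero_add, h01]
  have e1 : ∫ t in (0 : ℝ)..1, (⌊t + κ⌋ : ℝ) = ∫ t in κ..(κ + 1), (⌊t⌋ : ℝ) := by
    rw [intervalIntegral.integral_comp_add_right (fun t => (⌊t⌋ : ℝ)) κ, zero_add, add_comm 1]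
  have e2 : ∀ t : ℝ, (⌊t⌋ : ℝ) = t - Int.fract t := fun t => by rw [Int.self_sub_fract]
  rw [e1]
  simp_rw [e2]
  rw [intervalIntegral.integral_sub intervalIntegral.intervalIntegrable_id (hfi _ _), hsum,
    integral_id]
  ring

theorem floor_fract_sub (l β : ℝ) (i k : ℕ) :
    (⌊Int.fract (l * i + β) + -(l * k)⌋ : ℝ) = ⌊l * (i - k) + β⌋ - ⌊l * i + β⌋ := by
  rw [← Int.cast_sub, ← Int.floor_sub_intCast]
  congr 2
  rw [← Int.self_sub_floor]
  ring

/-- Raising `k` by one adds a telescoping sum, which leaves the difference of two floors whose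
arguments differ by `l * N`. Each such step costs an error of at most 1. -/
theorem abs_sum_floor_sub_le (l β : ℝ) (N k : ℕ) :
    |∑ i ∈ Finset.range N, ((⌊l * (i - k) + β⌋ : ℝ) - ⌊l * i + β⌋) - N * -(l * k)| ≤ k := by
  rw [Finset.sum_sub_distrib]
  induction k with
  | zero => simp
  | succ k ih =>
    have htel : ∑ i ∈ Finset.range N, (⌊l * (i - (k + 1 : ℕ)) + β⌋ : ℝ)
        - ∑ i ∈ Finset.range N, (⌊l * (i - k) + β⌋ : ℝ)
        = ⌊l * (0 - (k + 1 : ℕ)) + β⌋ - ⌊l * (N - (k + 1 : ℕ)) + β⌋ := by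
      have := Finset.sum_range_sub' (fun i : ℕ => (⌊l * (i - (k + 1 : ℕ)) + β⌋ : ℝ)) N
      rw [Nat.cast_zero] at this
      rw [← this, ← Finset.sum_sub_distrib]
      refine Finset.sum_congr rfl fun i _ => ?_
      push_cast
      ring_nf
    have h2 := Int.floor_le (l * (0 - (k + 1 : ℕ)) + β)
    have h3 := Int.lt_floor_add_one (l * (0 - (k + 1 : ℕ)) + β)
    have h4 := Int.floor_le (l * (N - (k + 1 : ℕ)) + β)
    have h5 := Int.lt_floor_add_one (l * (N - (k + 1 : ℕ)) + β)
    rw [abs_le] at ih ⊢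
    push_cast at *
    constructor <;> linarith [ih.1, ih.2]

theorem boundedDiscrepancy_floor (l : ℝ) (k : ℕ) :
    BoundedDiscrepancy l fun t => (⌊t + -(l * k)⌋ : ℝ) := by
  refine ⟨Monotone.intervalIntegrable fun s t hst => by gcongr, k, fun β N => ?_⟩
  rw [integral_floor_add]
  simp_rw [floor_fract_sub]
  exact abs_sum_floor_sub_le l β N k

/-- The indicator function of `[s, ∞)`. -/
noncomputable def threshold (s t : ℝ) : ℝ := if s ≤ t then 1 else 0

/-- On the unit interval the floor has at most one jump. For integral `κ` the threshold is 1 and is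
never reached. -/
theorem floor_add_eq_threshold {t κ : ℝ} (ht : t ∈ Set.Ico (0 : ℝ) 1) :
    ⌊t + κ⌋ = ⌊κ⌋ + if 1 - Int.fract κ ≤ t then 1 else 0 := by
  have h0 := Int.fract_nonneg κ
  have h1 := Int.fract_lt_one κ
  have h2 := Int.self_sub_floor κ
  obtain ⟨ht0, ht1⟩ := ht
  rw [Int.floor_eq_iff]
  split_ifs with h <;> push_cast <;> constructor <;> linarith

theorem boundedDiscrepancy_threshold (l : ℝ) (k : ℕ) :
    BoundedDiscrepancy l (threshold (1 - Int.fract (-(l * k)))) := by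
  refine ((boundedDiscrepancy_floor l k).add
    (boundedDiscrepancy_const l (-(⌊-(l * k)⌋ : ℝ)))).congr fun t ht => ?_
  rw [floor_add_eq_threshold ht, threshold]
  push_cast
  ring

/-- A step function whose jumps occur at thresholds of bounded discrepancy has bounded
discrepancy. -/
theorem boundedDiscrepancy_threshold_mul (T : Finset ℝ)
    (hT : ∀ s ∈ T, BoundedDiscrepancy l (threshold s)) (Ψ : Finset ℝ → ℝ) {s₀ : ℝ}
    (hs₀ : BoundedDiscrepancy l (threshold s₀)) :
    BoundedDiscrepancy l fun t => threshold s₀ t * Ψ (T.filter (· ≤ t)) := by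
  induction T using Finset.induction_on generalizing Ψ s₀ with
  | empty =>
    simp only [Finset.filter_empty]
    simpa only [mul_comm] using hs₀.const_mul (Ψ ∅)
  | insert s T hs ih =>
    have hT' : ∀ s ∈ T, BoundedDiscrepancy l (threshold s) := fun u hu =>
      hT u (Finset.mem_insert_of_mem hu)
    -- The product of two thresholds is the threshold at their maximum. Splitting on `s ≤ t`
    -- therefore writes the function as a combination of three instances of the induction
    -- hypothesis.
    have hmax : BoundedDiscrepancy l (threshold (max s₀ s)) := by
      rcases max_choice s₀ s with h | h <;> rw [h]
      · exact hs₀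
      · exact hT s (Finset.mem_insert_self _ _)
    refine (((ih hT' (fun A => Ψ (insert s A)) hmax).add (ih hT' Ψ hs₀)).add
      ((ih hT' Ψ hmax).const_mul (-1))).congr fun t _ => ?_
    rw [Finset.filter_insert]
    by_cases h : s ≤ t
    · simp [threshold, h]
      split_ifs <;> ring
    · simp [threshold, h]

theorem boundedDiscrepancy_filter_le (T : Finset ℝ)
    (hT : ∀ s ∈ T, BoundedDiscrepancy l (threshold s)) (Ψ : Finset ℝ → ℝ) :
    BoundedDiscrepancy l fun t => Ψ (T.filter (· ≤ t)) := by
  have h0 : BoundedDiscrepancy l (threshold 0) :=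
    (boundedDiscrepancy_const l 1).congr fun t ht => by simp [threshold, ht.1]
  exact (boundedDiscrepancy_threshold_mul T hT Ψ h0).congr fun t ht => by simp [threshold, ht.1]

/-- Any function of finitely many of the past sites of the line with slope `l` and intercept `t`
has bounded discrepancy, as a function of `t`. -/
theorem boundedDiscrepancy_linePast (swap : Bool) (ε : ℤˣ) (l : ℝ) (n : ℕ)
    (e : Set (ℤ × ℤ) → ℝ) :
    BoundedDiscrepancy l fun t => e (latticePoint swap ε l t '' Set.Ico (-(n : ℤ)) 0) := by
  -- `s k` is the intercept at which the site over `-k` jumps. Hence the last `n` sites are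
  -- determined by which `s k` are at most `t`.
  set s : ℕ → ℝ := fun k => 1 - Int.fract (-(l * k)) with hs
  refine (boundedDiscrepancy_filter_le (l := l) ((Finset.range (n + 1)).image s) ?_ fun A =>
    e ((fun k : ℕ => orient swap ε (-(k : ℤ), ⌊-(l * k)⌋ + if s k ∈ A then 1 else 0)) ''
      Set.Icc 1 n)).congr fun t ht => ?_
  · intro u hu
    obtain ⟨k, -, rfl⟩ := Finset.mem_image.1 hu
    exact boundedDiscrepancy_threshold l k
  · congr 1
    have hk : ∀ k ∈ Set.Icc 1 n, orient swap ε (-(k : ℤ), ⌊-(l * k)⌋ +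
        if s k ∈ ((Finset.range (n + 1)).image s).filter (· ≤ t) then 1 else 0)
        = latticePoint swap ε l t (-(k : ℤ)) := by
      intro k hk
      have hmem : s k ∈ ((Finset.range (n + 1)).image s).filter (· ≤ t) ↔ s k ≤ t := by
        rw [Finset.mem_filter, and_iff_right]
        exact Finset.mem_image_of_mem _ (Finset.mem_range.2 (Nat.lt_succ_of_le hk.2))
      simp only [hmem]
      rw [latticePoint, hs, ← floor_add_eq_threshold ht]
      congr 3
      push_cast
      ring
    rw [Set.image_congr hk]
    ext p
    constructor
    · rintro ⟨k, hk, rfl⟩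
      exact ⟨-(k : ℤ), ⟨by have := hk.2; omega, by have := hk.1; omega⟩, rfl⟩
    · rintro ⟨z, hz, rfl⟩
      refine ⟨z.natAbs, ⟨by have := hz.2; omega, by have := hz.1; have := hz.2; omega⟩, ?_⟩
      have : -((z.natAbs : ℕ) : ℤ) = z := by have := hz.2; omega
      simp only [this]

end Equidistribution

/-! ### Lattice lines: averaging the means and assembling the estimates. -/

section Line

theorem orient_sub (swap : Bool) (ε : ℤˣ) (p q : ℤ × ℤ) :
    orient swap ε (p - q) = orient swap ε p - orient swap ε q := by
  cases swap <;> simp [orient, mul_sub]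

theorem latticePoint_sub (swap : Bool) (ε : ℤˣ) (l b : ℝ) (z z' : ℤ) :
    latticePoint swap ε l b z' - latticePoint swap ε l b z
      = latticePoint swap ε l (Int.fract (l * z + b)) (z' - z) := by
  rw [latticePoint, latticePoint, latticePoint, ← orient_sub, Prod.mk_sub_mk,
    ← Int.floor_sub_intCast, ← Int.self_sub_floor]
  congr 3
  push_cast
  ring

theorem latticePoint_injective (swap : Bool) (ε : ℤˣ) (l b : ℝ) :
    (latticePoint swap ε l b).Injective := by
  intro z z' h
  cases swap <;> simp [latticePoint, orient] at h
  · exact h.1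
  · exact h.2

theorem abs_le_of_latticePoint_mem_box {swap : Bool} {ε : ℤˣ} {l b : ℝ} {z : ℤ} {n : ℕ}
    (h : latticePoint swap ε l b z ∈ box n) : |z| ≤ n := by
  rw [mem_box] at h
  cases swap <;> simp [latticePoint, orient] at h
  · exact h.1
  · exact h.2

theorem zero_notMem_linePast (swap : Bool) (ε : ℤˣ) (l t : ℝ) :
    0 ∉ latticePoint swap ε l t '' Set.Iic (-1) := by
  rintro ⟨z, hz, h⟩
  have h2 : z = 0 := by
    cases swap <;> simp [latticePoint, orient] at h
    · exact h.1
    · exact h.2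
  simp [h2] at hz

/-- Recentring at a site keeps the slope and reduces the intercept modulo 1, so the intercepts form
an orbit of the rotation by `l`. Only `i` past sites have been visited by time `i`. -/
theorem pathPast_latticePoint (swap : Bool) (ε : ℤˣ) (l b : ℝ) (z : ℤ) (i : ℕ) :
    pathPast (fun j : ℕ => latticePoint swap ε l b (z + j)) i
      = latticePoint swap ε l (Int.fract (l * i + (l * z + b))) '' Set.Ico (-(i : ℤ)) 0 := by
  have hfr : l * ((z + i : ℤ) : ℝ) + b = l * i + (l * z + b) := by push_cast; ring
  ext p
  simp only [pathPast, latticePoint_sub, hfr, Set.mem_image, Set.mem_Iio, Set.mem_Ico]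
  constructor
  · rintro ⟨j, hj, rfl⟩
    exact ⟨z + j - (z + i), by omega, rfl⟩
  · rintro ⟨k, hk, rfl⟩
    refine ⟨(i + k).toNat, by omega, ?_⟩
    congr 1
    omega

theorem linePast_inter_box_eq (swap : Bool) (ε : ℤˣ) (l t : ℝ) {r n : ℕ} (h : r ≤ n) :
    latticePoint swap ε l t '' Set.Ico (-(n : ℤ)) 0 ∩ box r
      = latticePoint swap ε l t '' Set.Iic (-1) ∩ box r := by
  ext p
  constructor
  · rintro ⟨⟨z, hz, rfl⟩, hp⟩
    exact ⟨⟨z, by have := hz.2; simp only [Set.mem_Iic]; omega, rfl⟩, hp⟩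
  · rintro ⟨⟨z, hz, rfl⟩, hp⟩
    refine ⟨⟨z, ?_, rfl⟩, hp⟩
    have h1 := abs_le.1 (abs_le_of_latticePoint_mem_box hp)
    simp only [Set.mem_Iic, Set.mem_Ico] at hz ⊢
    omega

theorem segmentApprox_eq_image_range (swap : Bool) (ε : ℤˣ) (l x x' : ℝ) (n : ℕ) (a : ℝ) :
    segmentApprox swap ε l x x' n a
      = (Finset.range (⌊(n : ℝ) * x'⌋ + 1 - ⌈(n : ℝ) * x⌉).toNat).image
        fun j : ℕ => latticePoint swap ε l ((n : ℝ) * a) (⌈(n : ℝ) * x⌉ + j) := by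
  ext p
  simp only [segmentApprox, Finset.mem_image, Finset.mem_Icc, Finset.mem_range]
  constructor
  · rintro ⟨z, hz, rfl⟩
    refine ⟨(z - ⌈(n : ℝ) * x⌉).toNat, by omega, ?_⟩
    congr 1
    omega
  · rintro ⟨j, hj, rfl⟩
    exact ⟨_, by omega, rfl⟩

variable {Υ : Type*} [Fintype Υ] [MeasurableSpace Υ] [DiscreteMeasurableSpace Υ]
  {P : Measure (ℤ × ℤ → Υ)} [IsProbabilityMeasure P]

/-- The mean conditional informations along lines average to the specific entropy, uniformly in
the position of the line. -/
theorem exists_forall_abs_sum_integral_condInformation_sub_le (hzero : StrongZeroOneLaw P) {c : ℝ}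
    (h : LetterProbAbove P c) (hc1 : c < 1) (hc : 0 < c) (swap : Bool) (ε : ℤˣ) (l : ℝ)
    {δ : ℝ} (hδ : 0 < δ) :
    ∃ N₀ : ℕ, ∀ (b : ℝ) (z : ℤ), ∀ N ≥ N₀,
      |∑ i ∈ Finset.range N, ∫ ω, condInformation P c
          (pathPast (fun j : ℕ => latticePoint swap ε l b (z + j)) i) ω ∂P
        - N * lineEntropy P swap ε l| ≤ δ * N := by
  set K : ℝ := -Real.log c with hK
  have hK0 : 0 < K := neg_pos.2 (Real.log_neg hc hc1)
  set e : Set (ℤ × ℤ) → ℝ := fun W => ∫ ω, condInformation P c W ω ∂P with he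
  have heK : ∀ W, |e W| ≤ K := fun W => by
    have := norm_integral_le_of_norm_le_const (μ := P) (f := condInformation P c W) (C := K)
      (Eventually.of_forall (abs_condInformation_le hc1 hc W))
    rwa [probReal_univ, mul_one] at this
  set past : ℝ → Set (ℤ × ℤ) := fun t => latticePoint swap ε l t '' Set.Iic (-1) with hpast
  set trunc : ℕ → ℝ → Set (ℤ × ℤ) :=
    fun n t => latticePoint swap ε l t '' Set.Ico (-(n : ℤ)) 0 with htrunc
  have hunif : ∀ η > 0, ∃ r : ℕ, ∀ n ≥ r, ∀ t, |e (trunc n t) - e (past t)| ≤ η := by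
    intro η hη
    obtain ⟨r, hr⟩ := exists_box_integral_condInformation_sub_le hzero hc1 hc (half_pos hη)
    have hr' : ∀ W : Set (ℤ × ℤ), |e W - e (W ∩ box r)| ≤ η / 2 := fun W => by
      simp only [he]
      rw [← integral_sub (integrable_condInformation hc1 hc _)
        (integrable_condInformation hc1 hc _)]
      exact abs_integral_le_integral_abs.trans (hr W)
    refine ⟨r, fun n hn t => ?_⟩
    have h1 := hr' (trunc n t)
    have h2 := hr' (past t)
    rw [abs_sub_comm] at h2
    rw [htrunc] at h1
    simp only at h1
    rw [linePast_inter_box_eq swap ε l t hn] at h1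
    have h3 := abs_sub_le (e (trunc n t)) (e (past t ∩ box r)) (e (past t))
    linarith
  have hint : ∀ n, BoundedDiscrepancy l fun t => e (trunc n t) :=
    fun n => boundedDiscrepancy_linePast swap ε l n e
  have hpt : ∀ t, Tendsto (fun n => e (trunc n t)) atTop (𝓝 (e (past t))) := fun t => by
    rw [Metric.tendsto_atTop]
    intro η hη
    obtain ⟨r, hr⟩ := hunif (η / 2) (half_pos hη)
    exact ⟨r, fun n hn => (hr n hn t).trans_lt (half_lt_self hη)⟩
  -- Measurability in the intercept is inherited from the truncated means, which converge pointwise.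
  have hpasti : IntervalIntegrable (fun t => e (past t)) volume 0 1 := by
    refine (intervalIntegrable_const (c := K)).mono_fun ?_ (Eventually.of_forall fun t => ?_)
    · exact aestronglyMeasurable_of_tendsto_ae atTop
        (fun n => (hint n).1.aestronglyMeasurable_restrict_uIoc) (Eventually.of_forall hpt)
    · exact (heK _).trans (le_abs_self _)
  have hline : lineEntropy P swap ε l = ∫ t in (0 : ℝ)..1, e (past t) := by
    rw [lineEntropy]
    refine intervalIntegral.integral_congr fun t _ => ?_
    exact (integral_condInformation h hc1 hc (zero_notMem_linePast swap ε l t)).symm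
  obtain ⟨r, hr⟩ := hunif (δ / 6) (by positivity)
  obtain ⟨hri, C, hC⟩ := hint r
  have hdiff : |(∫ t in (0 : ℝ)..1, e (trunc r t)) - ∫ t in (0 : ℝ)..1, e (past t)| ≤ δ / 6 := by
    rw [← intervalIntegral.integral_sub hri hpasti]
    have := intervalIntegral.norm_integral_le_of_norm_le_const (a := 0) (b := 1)
      (f := fun t => e (trunc r t) - e (past t)) (C := δ / 6) fun t _ => hr r le_rfl t
    simpa using this
  -- The discrepancy `C` and the first `r` sites, whose pasts may be too short, together cost at
  -- most `δ / 2 * N`. The truncations of the summands and of the integral cost `δ / 3` and `δ / 6`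
  -- per site.
  obtain ⟨N₀, hN₀⟩ := exists_nat_ge ((C + 2 * K * r) * 2 / δ)
  refine ⟨N₀, fun b z N hN => ?_⟩
  set τ : ℕ → ℝ := fun i => Int.fract (l * i + (l * z + b)) with hτ
  have hsum : ∀ i : ℕ, |e (trunc i (τ i)) - e (trunc r (τ i))|
      ≤ δ / 3 + if i ∈ Finset.range r then 2 * K else 0 := by
    intro i
    split_ifs with hi
    · have h1 := abs_sub (e (trunc i (τ i))) (e (trunc r (τ i)))
      have h2 := heK (trunc i (τ i))
      have h3 := heK (trunc r (τ i))
      linarith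
    · have h1 := hr i (by simpa using hi) (τ i)
      have h2 := hr r le_rfl (τ i)
      rw [abs_sub_comm] at h2
      have h3 := abs_sub_le (e (trunc i (τ i))) (e (past (τ i))) (e (trunc r (τ i)))
      linarith
  have hsum' : |∑ i ∈ Finset.range N, e (trunc i (τ i)) - ∑ i ∈ Finset.range N, e (trunc r (τ i))|
      ≤ N * (δ / 3) + r * (2 * K) := by
    rw [← Finset.sum_sub_distrib]
    refine (Finset.abs_sum_le_sum_abs _ _).trans ((Finset.sum_le_sum fun i _ => hsum i).trans ?_)
    rw [Finset.sum_add_distrib, ← Finset.sum_filter, Finset.sum_const, Finset.sum_const,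
      Finset.card_range, nsmul_eq_mul, nsmul_eq_mul]
    have h1 : (((Finset.range N).filter fun i => i ∈ Finset.range r).card : ℝ) ≤ r := by
      have h2 : ((Finset.range N).filter fun i => i ∈ Finset.range r) ⊆ Finset.range r :=
        fun i hi => (Finset.mem_filter.1 hi).2
      have := Finset.card_le_card h2
      rw [Finset.card_range] at this
      exact_mod_cast this
    gcongr
  have hNr : (N₀ : ℝ) ≤ N := by exact_mod_cast hN
  have hbig := hN₀.trans hNr
  rw [div_le_iff₀ hδ] at hbig
  have hpath : ∀ i, ∫ ω, condInformation P c
      (pathPast (fun j : ℕ => latticePoint swap ε l b (z + j)) i) ω ∂P = e (trunc i (τ i)) :=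
    fun i => by rw [pathPast_latticePoint]
  simp_rw [hpath]
  rw [hline]
  have h1 := hC (l * z + b) N
  have h2 : |N * (∫ t in (0 : ℝ)..1, e (trunc r t)) - N * ∫ t in (0 : ℝ)..1, e (past t)|
      ≤ N * (δ / 6) := by
    rw [← mul_sub, abs_mul, Nat.abs_cast]
    gcongr
  rw [abs_le] at h1 h2 hsum' ⊢
  constructor <;> linarith [h1.1, h1.2, h2.1, h2.2, hsum'.1, hsum'.2]

/-- The information per site of the lattice approximation of a line segment with many sites is close
to the specific entropy, uniformly in the position of the line. -/
theorem exists_forall_integral_abs_information_sub_le (hstat : IsStationaryField P)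
    (hzero : StrongZeroOneLaw P) {c : ℝ} (h : LetterProbAbove P c) (hc1 : c < 1) (hc : 0 < c)
    (swap : Bool) (ε : ℤˣ) (l : ℝ) {δ : ℝ} (hδ : 0 < δ) :
    ∃ N₀ : ℕ, ∀ (b : ℝ) (z : ℤ), ∀ N ≥ N₀,
      eLpNorm (fun ω => (N : ℝ)⁻¹ * information P
        ((Finset.range N).image fun j : ℕ => latticePoint swap ε l b (z + j)) ω
          - lineEntropy P swap ε l) 1 P ≤ ENNReal.ofReal δ := by
  obtain ⟨N₁, hN₁⟩ := exists_forall_integral_abs_sum_condInformation_le hstat hzero hc1 hc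
    (half_pos hδ)
  obtain ⟨N₂, hN₂⟩ := exists_forall_abs_sum_integral_condInformation_sub_le hzero h hc1 hc
    swap ε l (half_pos hδ)
  refine ⟨max 1 (max N₁ N₂), fun b z N hN => ?_⟩
  simp only [ge_iff_le, max_le_iff] at hN
  set v : ℕ → ℤ × ℤ := fun j => latticePoint swap ε l b (z + j) with hv
  have hvinj : v.Injective := fun i j hij => by
    have := latticePoint_injective swap ε l b hij
    omega
  have hN0 : (0 : ℝ) < N := by exact_mod_cast hN.1
  have h1 := hN₁ v hvinj N hN.2.1
  have h2 := hN₂ b z N hN.2.2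
  simp_rw [information_image_range hstat h hc hvinj N]
  set m : ℕ → ℝ := fun i => ∫ ω, condInformation P c (pathPast v i) ω ∂P with hm
  have hgi : ∀ i, Integrable (fun ω => condInformation P c (pathPast v i) (shift (v i) ω)) P :=
    fun i => (hstat (v i)).integrable_comp_of_integrable (integrable_condInformation hc1 hc _)
  have hSi : Integrable (fun ω => ∑ i ∈ Finset.range N,
      condInformation P c (pathPast v i) (shift (v i) ω)) P :=
    integrable_finsetSum _ fun i _ => hgi i
  have hDi : Integrable (fun ω => ∑ i ∈ Finset.range N,
      (condInformation P c (pathPast v i) (shift (v i) ω) - m i)) P :=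
    integrable_finsetSum _ fun i _ => (hgi i).sub (integrable_const _)
  have hLi : Integrable (fun ω => (N : ℝ)⁻¹ * ∑ i ∈ Finset.range N,
      condInformation P c (pathPast v i) (shift (v i) ω) - lineEntropy P swap ε l) P :=
    (hSi.const_mul _).sub (integrable_const _)
  rw [eLpNorm_one_eq_lintegral_enorm, ← ofReal_integral_norm_eq_lintegral_enorm hLi]
  refine ENNReal.ofReal_le_ofReal ?_
  have hpt : ∀ ω, ‖(N : ℝ)⁻¹ * ∑ i ∈ Finset.range N,
      condInformation P c (pathPast v i) (shift (v i) ω) - lineEntropy P swap ε l‖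
      ≤ (N : ℝ)⁻¹ * |∑ i ∈ Finset.range N,
        (condInformation P c (pathPast v i) (shift (v i) ω) - m i)| + δ / 2 := by
    intro ω
    -- The deviation splits into the fluctuation about the means and the deviation of the averaged
    -- means, each within `δ / 2`.
    have e1 : (N : ℝ)⁻¹ * ∑ i ∈ Finset.range N,
        condInformation P c (pathPast v i) (shift (v i) ω) - lineEntropy P swap ε l
        = (N : ℝ)⁻¹ * ∑ i ∈ Finset.range N,
          (condInformation P c (pathPast v i) (shift (v i) ω) - m i)
          + (N : ℝ)⁻¹ * (∑ i ∈ Finset.range N, m i - N * lineEntropy P swap ε l) := by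
      rw [Finset.sum_sub_distrib]
      field_simp
      ring
    have h3 : (N : ℝ)⁻¹ * |∑ i ∈ Finset.range N, m i - N * lineEntropy P swap ε l| ≤ δ / 2 := by
      rw [inv_mul_le_iff₀ hN0]
      exact h2.trans_eq (mul_comm _ _)
    rw [e1, Real.norm_eq_abs]
    refine (abs_add_le _ _).trans ?_
    rw [abs_mul, abs_mul, abs_of_pos (inv_pos.2 hN0)]
    exact add_le_add le_rfl h3
  refine (integral_mono_of_nonneg (Eventually.of_forall fun _ => norm_nonneg _)
    ((hDi.abs.const_mul _).add (integrable_const _)) (Eventually.of_forall hpt)).trans ?_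
  have h4 : (N : ℝ)⁻¹ * ∫ ω, |∑ i ∈ Finset.range N,
      (condInformation P c (pathPast v i) (shift (v i) ω) - m i)| ∂P ≤ δ / 2 := by
    rw [inv_mul_le_iff₀ hN0]
    exact h1.trans_eq (mul_comm _ _)
  refine (integral_add (hDi.abs.const_mul _) (integrable_const _)).le.trans ?_
  rw [integral_const_mul, integral_const, probReal_univ, one_smul]
  linarith

end Line

/-! ### The limit theorem for blowups of segments. -/

theorem theorem4p1 {Υ : Type*} [Fintype Υ] [MeasurableSpace Υ] [DiscreteMeasurableSpace Υ]
    (P : Measure (ℤ × ℤ → Υ)) [IsProbabilityMeasure P]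
    (hstat : IsStationaryField P) (hzero : StrongZeroOneLaw P) (hpos : UniformlyPositive P)
    (swap : Bool) (ε : ℤˣ) (l : ℝ) (hl : l ∈ Set.Icc (0 : ℝ) 1)
    (x x' : ℝ) (hx : x < x') :
    Tendsto
      (fun n : ℕ => ⨆ a : ℝ,
        eLpNorm
          (fun ω => ((segmentApprox swap ε l x x' n a).card : ℝ)⁻¹ *
              information P (segmentApprox swap ε l x x' n a) ω - lineEntropy P swap ε l)
          1 P)
      atTop (𝓝 0) := by
  obtain ⟨c, hc, hcond⟩ := hpos
  have h : LetterProbAbove P c := letterProbAbove_of_forall_cond hcond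
  have : Nonempty Υ := by
    obtain ⟨ω⟩ := nonempty_of_isProbabilityMeasure P
    exact ⟨ω 0⟩
  have hc1 := h.lt_one
  refine ENNReal.tendsto_nhds_zero.2 fun η hη => ?_
  obtain ⟨δ, hδ0, hδη⟩ := ENNReal.lt_iff_exists_real_btwn.1 hη
  have hδ : 0 < δ := by simpa using hδη.1
  obtain ⟨N₀, hN₀⟩ :=
    exists_forall_integral_abs_information_sub_le hstat hzero h hc1 hc swap ε l hδ
  have hlarge : ∀ᶠ n : ℕ in atTop, ((N₀ : ℝ) + 1) / (x' - x) ≤ n :=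
    tendsto_natCast_atTop_atTop.eventually_ge_atTop _
  filter_upwards [hlarge] with n hn
  refine iSup_le fun a => ?_
  refine le_trans ?_ hδη.2.le
  -- The number of sites exceeds `n * (x' - x) - 1` whatever `a` is, so one threshold handles the
  -- whole supremum.
  have hcard : N₀ ≤ (⌊(n : ℝ) * x'⌋ + 1 - ⌈(n : ℝ) * x⌉).toNat := by
    rw [div_le_iff₀ (sub_pos.2 hx)] at hn
    have h1 := Int.lt_floor_add_one ((n : ℝ) * x')
    have h2 := Int.ceil_lt_add_one ((n : ℝ) * x)
    have h3 : (N₀ : ℝ) < ((⌊(n : ℝ) * x'⌋ + 1 - ⌈(n : ℝ) * x⌉ : ℤ) : ℝ) := by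
      push_cast
      linarith
    have h4 : (N₀ : ℤ) < ⌊(n : ℝ) * x'⌋ + 1 - ⌈(n : ℝ) * x⌉ := by exact_mod_cast h3
    omega
  have hinj : Function.Injective fun j : ℕ =>
      latticePoint swap ε l ((n : ℝ) * a) (⌈(n : ℝ) * x⌉ + j) := fun i j hij => by
    have := latticePoint_injective swap ε l _ hij
    omega
  rw [segmentApprox_eq_image_range, Finset.card_image_of_injective _ hinj, Finset.card_range]
  exact hN₀ _ _ _ hcard
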